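/- Consider the uplink of a single cell with $M$ base-station antennas and $K$ single-antenna users. Write $\mathrm{diag}(\mathbf X)$ for the matrix $\mathbf X$ with its off-diagonal entries set to zero and $\mathrm{abs}(\mathbf X)^2$ for the entrywise squared modulus. Let $\mathbf R_1,\dots,\mathbf R_K\in\mathbb C^{M\times M}$ be positive semidefinite, $\mathbf D_{\mathbf R_i}=\mathrm{diag}(\mathbf R_i)$, $\mathbf D_\epsilon=\mathrm{diag}(\epsilon_1,\dots,\epsilon_M)$ with $\epsilon_m\in\mathbb R$, $\sigma>0$, and let $p_i\ge 0$ and $q_i\ge 0$ be the data and pilot energies. Let $\boldsymbol\phi_1,\dots,\boldsymbol\phi_K\in\mathbb C^{\tau_p}$, $\tau_p\ge1$, be pilots with unit-modulus entries and $\boldsymbol\phi_i^H\boldsymbol\phi_k=\tau_p\delta_{ik}$. The following random quantities are mutually independent: channels $\mathbf h_i\sim\mathcal{CN}(\mathbf 0,\mathbf R_i)$; pilot noises $\mathbf n_j\sim\mathcal{CN}(\mathbf 0,\sigma^2\mathbf I_M)$ and pilot distortion vectors $\mathbf r_j\sim\mathcal{CN}(\mathbf 0,\mathbf I_M)$, $1\le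 j\le\tau_p$; and, at a data sample, symbols $s_i\sim\mathcal{CN}(0,1)$, noise $\mathbf n\sim\mathcal{CN}(\mathbf 0,\sigma^2\mathbf I_M)$ and distortion vector $\mathbf r\sim\mathcal{CN}(\mathbf 0,\mathbf I_M)$. When the users send $x_1,\dots,x_K$, with noise $\mathbf n$ and distortion vector $\mathbf r$, the received signal is $$\mathbf y=\sum_{i=1}^K\mathbf h_ix_i+\mathbf n+\mathbf e,\qquad \mathbf e=\mathbf D_\epsilon\Big(\sum_{i=1}^K\mathbb E\{|x_i|^2\}\,\mathrm{diag}(|[\mathbf h_i]_1|^2,\dots,|[\mathbf h_i]_M|^2)\Big)^{1/2}\mathbf r .$$ At pilot sample $j$, $x_i=\sqrt{q_i}[\boldsymbol\phi_i]_j$, the noise and distortion vectors are $\mathbf n_j,\mathbf r_j$, and the received signal is the $j$th column of $\mathbf Y_p$. At the data sample $x_i=\sqrt{p_i}s_i$, and $\mathbf y$, $\mathbf e$ below refer to this sample. Fix a user $k$ with $q_k>0$. Let $\mathbf z_k=\mathbf Y_p\boldsymbol\phi_k^*/(\tau_p\sqrt{q_k})$, let $\hat{\mathbf h}_k=\mathbb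 E\{\mathbf h_k\mathbf z_k^H\}(\mathbb E\{\mathbf z_k\mathbf z_k^H\})^{-1}\mathbf z_k$ be the LMMSE estimate of $\mathbf h_k$, use the MR combiner $\mathbf v_k=\hat{\mathbf h}_k$, and put $\hat s_k=\mathbf v_k^H\mathbf y$. The effective SINR is $$\mathrm{SINR}_k=\frac{|\mathbb E\{\hat s_ks_k^*\}|^2}{\mathbb{V}\mathsf{ar}(\hat s_k-\mathbb E\{\hat s_ks_k^*\}s_k)} .$$ Let $$\boldsymbol\Psi_k=\mathbf R_k+\frac1{\tau_pq_k}\Big(\sigma^2\mathbf I_M+\sum_{i=1}^Kq_i\mathbf D_\epsilon\mathbf D_{\mathbf R_i}\mathbf D_\epsilon\Big).$$ Then all the moments involved are finite, $\mathbb E\{\mathbf z_k\mathbf z_k^H\}$ and $\boldsymbol\Psi_k$ are invertible, and $\mathrm{SINR}_k=N_k/D_k$ with $$N_k=p_k\,\mathrm{tr}(\mathbf R_k\boldsymbol\Psi_k^{-1}\mathbf R_k)^2,$$ $$\begin{aligned}D_k={}&p_k\,\mathrm{tr}\big(\mathbf D_\epsilon^2\,\mathrm{abs}(\mathrm{diag}(\mathbf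 R_k\boldsymbol\Psi_k^{-1}\mathbf R_k))^2\big)\\&+\sum_{i=1}^K\frac{p_iq_i}{\tau_pq_k}\,\mathrm{tr}\Big(\mathbf D_\epsilon^2\,\mathrm{abs}(\mathrm{diag}(\mathbf R_i\mathbf R_k\boldsymbol\Psi_k^{-1}))^2+\mathbf D_\epsilon^2\,\mathrm{diag}\big(\mathrm{abs}(\mathbf R_k\boldsymbol\Psi_k^{-1})^2\,\mathbf D_\epsilon^2\,\mathrm{abs}(\mathbf R_i)^2\big)\Big)\\&+\mathrm{tr}\Big(\Big(\sum_{i=1}^Kp_i\mathbf R_i+\sigma^2\mathbf I_M+\sum_{i=1}^Kp_i\mathbf D_\epsilon^2\mathbf D_{\mathbf R_i}\Big)\mathbf R_k\boldsymbol\Psi_k^{-1}\mathbf R_k\Big),\end{aligned}$$ where $D_k>0$ whenever $\mathbf R_k\ne\mathbf 0$ (if $\mathbf R_k=\mathbf 0$, then $N_k=D_k=0$ and both quotients are read as $0$). The same closed form is also equal to $$\frac{|\mathbb E\{\mathbf v_k^H\mathbf h_k\}|^2p_k}{\sum_{i=1}^K\mathbb E\{|\mathbf v_k^H\mathbf h_i|^2\}p_i-|\mathbb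 E\{\mathbf v_k^H\mathbf h_k\}|^2p_k+\mathbb E\{|\mathbf v_k^H\mathbf n|^2\}+\mathbb E\{|\mathbf v_k^H\mathbf e|^2\}} .$$ -/

import Mathlib

open MeasureTheory ProbabilityTheory Matrix
open scoped ComplexOrder MatrixOrder

noncomputable section

namespace MIMO

/-! ### Circularly symmetric complex Gaussian laws -/

/-- The law `CN(0, 1)` on `ℂ`: independent real and imaginary parts, each `N(0, 1/2)`. -/
def stdComplexGaussian : Measure ℂ :=
  ((gaussianReal 0 (1 / 2)).prod (gaussianReal 0 (1 / 2))).map (fun x => (⟨x.1, x.2⟩ : ℂ))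

/-- The law `CN(0, C)` on `ℂ^M` for a positive semidefinite covariance matrix `C`: the law of
`C^{1/2} g`, where `g` has i.i.d. `CN(0, 1)` entries. -/
def complexGaussian {M : ℕ} (C : Matrix (Fin M) (Fin M) ℂ) : Measure (Fin M → ℂ) :=
  (Measure.pi fun _ : Fin M => stdComplexGaussian).map (fun g => CFC.sqrt C *ᵥ g)

/-! ### Matrix operations -/

/-- `diag(X)` for a matrix `X`: all off-diagonal entries are set to zero. -/
def diagPart {M : ℕ} (X : Matrix (Fin M) (Fin M) ℂ) : Matrix (Fin M) (Fin M) ℂ :=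
  Matrix.diagonal X.diag

/-- `abs(X)²`: the squared absolute value is taken entry by entry. -/
def absSq {M : ℕ} (X : Matrix (Fin M) (Fin M) ℂ) : Matrix (Fin M) (Fin M) ℂ :=
  X.map fun z => ((‖z‖ ^ 2 : ℝ) : ℂ)

/-- `diag(a₁, …, a_M)` for a real vector `a`, as a complex matrix. -/
def realDiag {M : ℕ} (a : Fin M → ℝ) : Matrix (Fin M) (Fin M) ℂ :=
  Matrix.diagonal fun m => (a m : ℂ)

/-! ### The uplink model -/

/-- Deterministic parameters of a single-cell uplink with `M` antennas, `K` users and pilots of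
length `τp`: spatial correlation matrices `R i`, distortion levels `ε m`, noise standard deviation
`σ`, data energies `p i`, pilot energies `q i` and pilot sequences `φ i`. -/
structure Params (M K τp : ℕ) where
  R : Fin K → Matrix (Fin M) (Fin M) ℂ
  ε : Fin M → ℝ
  σ : ℝ
  p : Fin K → ℝ
  q : Fin K → ℝ
  φ : Fin K → Fin τp → ℂ

/-- The pilots have unit-modulus entries and are mutually orthogonal:
`φᵢᴴ φₖ = τp` if `i = k`, and `0` otherwise. -/
def Params.OrthogonalPilots {M K τp : ℕ} (S : Params M K τp) : Prop :=
  (∀ i j, ‖S.φ i j‖ = 1) ∧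
    ∀ i k, star (S.φ i) ⬝ᵥ S.φ k = if i = k then (τp : ℂ) else 0

/-- The random quantities of one coherence block: channels `h i`; thermal noise `N j` and distortion
randomness `rp j` at pilot sample `j`; data symbols `s i`, thermal noise `n` and distortion
randomness `r` at an arbitrary data sample. -/
structure Signals (Ω : Type*) (M K τp : ℕ) where
  h : Fin K → Ω → Fin M → ℂ
  N : Fin τp → Ω → Fin M → ℂ
  rp : Fin τp → Ω → Fin M → ℂ
  s : Fin K → Ω → ℂ
  n : Ω → Fin M → ℂ
  r : Ω → Fin M → ℂ

/-- The random quantities are mutually independent (their joint law is a product measure), with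
`h i ∼ CN(0, R i)`, `N j, n ∼ CN(0, σ² I)`, `rp j, r ∼ CN(0, I)` and `s i ∼ CN(0, 1)`. -/
def Signals.HasModelLaw {Ω : Type*} [MeasurableSpace Ω] {M K τp : ℕ}
    (X : Signals Ω M K τp) (S : Params M K τp) (P : Measure Ω) : Prop :=
  HasLaw
    (fun ω => (fun i => X.h i ω, fun j => X.N j ω, fun j => X.rp j ω, fun i => X.s i ω,
      X.n ω, X.r ω))
    ((Measure.pi fun i : Fin K => complexGaussian (S.R i)).prod
      ((Measure.pi fun _ : Fin τp => complexGaussian (realDiag fun _ : Fin M => S.σ ^ 2)).prod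
        ((Measure.pi fun _ : Fin τp => complexGaussian (1 : Matrix (Fin M) (Fin M) ℂ)).prod
          ((Measure.pi fun _ : Fin K => stdComplexGaussian).prod
            ((complexGaussian (realDiag fun _ : Fin M => S.σ ^ 2)).prod
              (complexGaussian (1 : Matrix (Fin M) (Fin M) ℂ)))))))
    P

section Model

variable {Ω : Type*} [MeasurableSpace Ω] {M K τp : ℕ}

/-- The diagonal of `D_h = ∑ᵢ E{|xᵢ|²} diag(|[hᵢ]₁|², …, |[hᵢ]_M|²)`: the instantaneous energy
received at each antenna when the users transmit `x`. -/
def receivedEnergy (P : Measure Ω) (h : Fin K → Ω → Fin M → ℂ) (x : Fin K → Ω → ℂ)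
    (ω : Ω) (m : Fin M) : ℝ :=
  ∑ i, (∫ ω', ‖x i ω'‖ ^ 2 ∂P) * ‖h i ω m‖ ^ 2

/-- The hardware distortion `e = D_ε D_h^{1/2} r`. -/
def distortion (P : Measure Ω) (ε : Fin M → ℝ) (h : Fin K → Ω → Fin M → ℂ) (x : Fin K → Ω → ℂ)
    (r : Ω → Fin M → ℂ) (ω : Ω) : Fin M → ℂ :=
  (realDiag ε * realDiag fun m => Real.sqrt (receivedEnergy P h x ω m)) *ᵥ r ω

/-- The received signal `y = ∑ᵢ hᵢ xᵢ + n + e`. -/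
def received (P : Measure Ω) (ε : Fin M → ℝ) (h : Fin K → Ω → Fin M → ℂ) (x : Fin K → Ω → ℂ)
    (n r : Ω → Fin M → ℂ) (ω : Ω) : Fin M → ℂ :=
  (∑ i, x i ω • h i ω) + n ω + distortion P ε h x r ω

/-- The signals sent at pilot sample `j`: user `i` sends `√qᵢ [φᵢ]ⱼ`. -/
def pilotInput (S : Params M K τp) (j : Fin τp) : Fin K → Ω → ℂ :=
  fun i _ => (Real.sqrt (S.q i) : ℂ) * S.φ i j

/-- The signals sent at a data sample: user `i` sends `√pᵢ sᵢ`. -/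
def dataInput (S : Params M K τp) (X : Signals Ω M K τp) : Fin K → Ω → ℂ :=
  fun i ω => (Real.sqrt (S.p i) : ℂ) * X.s i ω

/-- Column `j` of the received pilot signal. -/
def pilotReceived (S : Params M K τp) (X : Signals Ω M K τp) (P : Measure Ω) (j : Fin τp) :
    Ω → Fin M → ℂ :=
  received P S.ε X.h (pilotInput S j) (X.N j) (X.rp j)

/-- The de-spread channel observation `zₖ = Y_p φₖ^* / (τp √qₖ)`. -/
def observation (S : Params M K τp) (X : Signals Ω M K τp) (P : Measure Ω) (k : Fin K)
    (ω : Ω) : Fin M → ℂ :=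
  ((τp * Real.sqrt (S.q k) : ℝ) : ℂ)⁻¹ • ∑ j, star (S.φ k j) • pilotReceived S X P j ω

/-- The correlation matrix `E{a bᴴ}`. -/
def corr (P : Measure Ω) (a b : Ω → Fin M → ℂ) : Matrix (Fin M) (Fin M) ℂ :=
  Matrix.of fun m m' => ∫ ω, a ω m * star (b ω m') ∂P

/-- The linear minimum mean squared error estimate of `a` from `z`:
`E{a zᴴ} (E{z zᴴ})⁻¹ z`. -/
def lmmse (P : Measure Ω) (a z : Ω → Fin M → ℂ) (ω : Ω) : Fin M → ℂ :=
  (corr P a z * (corr P z z)⁻¹) *ᵥ z ω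

/-- The maximum-ratio combining vector: the LMMSE estimate of `hₖ` from `zₖ`. -/
def mrCombiner (S : Params M K τp) (X : Signals Ω M K τp) (P : Measure Ω) (k : Fin K) :
    Ω → Fin M → ℂ :=
  lmmse P (X.h k) (observation S X P k)

/-- The hardware distortion `e` at a data sample. -/
def dataDistortion (S : Params M K τp) (X : Signals Ω M K τp) (P : Measure Ω) : Ω → Fin M → ℂ :=
  distortion P S.ε X.h (dataInput S X) X.r

/-- The received signal `y` at a data sample. -/
def dataReceived (S : Params M K τp) (X : Signals Ω M K τp) (P : Measure Ω) : Ω → Fin M → ℂ :=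
  received P S.ε X.h (dataInput S X) X.n X.r

/-- The inner product `vᴴ y` of random vectors, as a random variable. -/
def combine (v y : Ω → Fin M → ℂ) (ω : Ω) : ℂ := star (v ω) ⬝ᵥ y ω

/-- The variance `E|X - E X|²` of a complex random variable. -/
def complexVar (P : Measure Ω) (X : Ω → ℂ) : ℝ := ∫ ω, ‖X ω - ∫ ω', X ω' ∂P‖ ^ 2 ∂P

/-- The effective SINR of an observation `ŝ` of the data symbol `s`:
`|E{ŝ s^*}|² / Var(ŝ - E{ŝ s^*} s)`. -/
def effectiveSINR (P : Measure Ω) (shat s : Ω → ℂ) : ℝ :=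
  ‖∫ ω, shat ω * star (s ω) ∂P‖ ^ 2 /
    complexVar P (fun ω => shat ω - (∫ ω', shat ω' * star (s ω') ∂P) * s ω)

/-- The effective SINR of user `k` written through moments of the combining vector `v`. -/
def momentSINR (S : Params M K τp) (X : Signals Ω M K τp) (P : Measure Ω) (v : Ω → Fin M → ℂ)
    (k : Fin K) : ℝ :=
  (‖∫ ω, combine v (X.h k) ω ∂P‖ ^ 2 * S.p k) /
    ((∑ i, (∫ ω, ‖combine v (X.h i) ω‖ ^ 2 ∂P) * S.p i)
      - ‖∫ ω, combine v (X.h k) ω ∂P‖ ^ 2 * S.p k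
      + (∫ ω, ‖combine v X.n ω‖ ^ 2 ∂P)
      + ∫ ω, ‖combine v (dataDistortion S X P) ω‖ ^ 2 ∂P)

end Model

/-! ### The closed-form expression -/

section ClosedForm

variable {M K τp : ℕ}

/-- `Ψₖ = Rₖ + (1 / (τp qₖ)) (σ² I + ∑ᵢ qᵢ D_ε D_{Rᵢ} D_ε)`. -/
def Psi (S : Params M K τp) (k : Fin K) : Matrix (Fin M) (Fin M) ℂ :=
  S.R k + (1 / ((τp : ℂ) * S.q k)) •
    (((S.σ : ℂ) ^ 2) • (1 : Matrix (Fin M) (Fin M) ℂ) +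
      ∑ i, (S.q i : ℂ) • (realDiag S.ε * diagPart (S.R i) * realDiag S.ε))

/-- `pₖ tr(Rₖ Ψₖ⁻¹ Rₖ)²`. -/
def mrNum (S : Params M K τp) (k : Fin K) : ℂ :=
  (S.p k : ℂ) * (S.R k * (Psi S k)⁻¹ * S.R k).trace ^ 2

/-- The denominator of the closed-form SINR: self-distortion, then distortion from inter-user
interference together with the additional distortion from all users, then inter-user
interference, noise and data distortion. -/
def mrDen (S : Params M K τp) (k : Fin K) : ℂ :=
  (S.p k : ℂ) * (realDiag S.ε ^ 2 * absSq (diagPart (S.R k * (Psi S k)⁻¹ * S.R k))).trace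
  + ∑ i, ((S.p i : ℂ) * S.q i / ((τp : ℂ) * S.q k)) *
      (realDiag S.ε ^ 2 * absSq (diagPart (S.R i * S.R k * (Psi S k)⁻¹))
        + realDiag S.ε ^ 2 *
            diagPart (absSq (S.R k * (Psi S k)⁻¹) * realDiag S.ε ^ 2 * absSq (S.R i))).trace
  + (((∑ i, (S.p i : ℂ) • S.R i)
        + ((S.σ : ℂ) ^ 2) • (1 : Matrix (Fin M) (Fin M) ℂ)
        + ∑ i, (S.p i : ℂ) • (realDiag S.ε ^ 2 * diagPart (S.R i)))
      * (S.R k * (Psi S k)⁻¹ * S.R k)).trace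

end ClosedForm

end MIMO

end

open MIMO

/-!
The channels enter everything through a few moments, and each layer of randomness is averaged out in
turn, conditionally on the layers before it.

With `c = 1 / (τp qₖ)`, orthogonality of the pilots gives `zₖ = hₖ + w`, where
`wₘ = ηₘ + εₘ √(∑ⱼ qⱼ |[hⱼ]ₘ|²) ζₘ`. The families `η` and `ζ` are independent of the channels, centred
and uncorrelated, with variances `c σ²` and `c` (`observation_apply`,
`SignalMoments.white_despread`). Hence `E hₖ zₖᴴ = Rₖ` and `E zₖ zₖᴴ = Ψₖ`, so that `vₖ = A zₖ` with
`A = Rₖ Ψₖ⁻¹`. Here `Ψₖ` is positive definite because `σ² > 0`.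

The tool for a single layer is `White.integral_mul_star`: for random variables that are affine in a
white family, with coefficients independent of that family, a covariance is the sum of the
expectations of products of matching coefficients. It is applied to the pair `(η, ζ)` with
coefficients that depend on the channels, and to the inputs `(s, n, r)` of the data sample with
coefficients that depend on all that precedes it. The second application reduces the effective SINR
to its moment form (`SignalMoments.effectiveSINR_eq_momentSINR`). The first one reduces
`E |vₖᴴ hᵢ|²` and `E |[hᵢ]ₘ|² |[vₖ]ₘ|²` to moments of order four of the channels.

Those are given by Isserlis' formula (`integral_four_complexGaussian`), which is proved for
independent standard entries from circular symmetry and `E |z|⁴ = 2`, and transported by the square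
root of the covariance matrix. In each of the two quantities, the products of second moments add up
to an expression in `A Ψₖ Aᴴ = Rₖ Ψₖ⁻¹ Rₖ`, and the remaining pairings, between equal users, produce
the distortion terms that are specific to the closed form
(`SignalMoments.integral_normSq_combine_h`,
`SignalMoments.integral_normSq_h_mul_normSq_linearCombiner`).

All random variables that occur have finite moments of every order. `Tame` records this together
with the `σ`-algebra of the inputs on which a variable depends, so that integrability and
independence are preserved by algebraic operations.
-/

namespace MIMO

open scoped NNReal

/-! ### Random variables with finite moments of every order -/

/-- A complex random variable that is measurable with respect to the `σ`-algebra `m` and has finite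
absolute moments of every order. The `σ`-algebra records which random inputs the variable depends
on; it need not be contained in the ambient one, because the inputs are only a.e. measurable. -/
structure Tame {Ω : Type*} (m : MeasurableSpace Ω) {m₀ : MeasurableSpace Ω} (P : Measure Ω)
    (f : Ω → ℂ) : Prop where
  measurable : Measurable[m] f
  memLp : ∀ p : ℝ≥0, MemLp f p P

section Tame

variable {Ω : Type*} {m m' m₁ m₂ m₀ : MeasurableSpace Ω} {P : Measure Ω}
  {f g : Ω → ℂ}

lemma Tame.mono (h : m ≤ m') (hf : Tame m P f) : Tame m' P f :=
  ⟨hf.measurable.mono h le_rfl, hf.memLp⟩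

lemma Tame.memLp_two (hf : Tame m P f) : MemLp f 2 P := by
  simpa using hf.memLp 2

lemma Tame.integrable (hf : Tame m P f) : Integrable f P := by
  rw [← memLp_one_iff_integrable]
  simpa using hf.memLp 1

lemma Tame.add (hf : Tame m P f) (hg : Tame m P g) : Tame m P (fun ω => f ω + g ω) :=
  ⟨hf.measurable.add hg.measurable, fun p => (hf.memLp p).add (hg.memLp p)⟩

lemma Tame.sub (hf : Tame m P f) (hg : Tame m P g) : Tame m P (fun ω => f ω - g ω) :=
  ⟨hf.measurable.sub hg.measurable, fun p => (hf.memLp p).sub (hg.memLp p)⟩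

lemma Tame.mul (hf : Tame m P f) (hg : Tame m P g) : Tame m P (fun ω => f ω * g ω) := by
  refine ⟨hf.measurable.mul hg.measurable, fun p => ?_⟩
  -- Hölder's inequality with exponents `1 / p = 1 / (2p) + 1 / (2p)`
  have : ENNReal.HolderTriple ((2 * p : ℝ≥0) : ENNReal) ((2 * p : ℝ≥0) : ENNReal)
      (p : ENNReal) := by
    constructor
    rcases eq_or_ne p 0 with rfl | hp
    · simp
    · have h2 : (2 * p : ℝ≥0) ≠ 0 := by positivity
      rw [← ENNReal.coe_inv h2, ← ENNReal.coe_inv hp, ← ENNReal.coe_add]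
      congr 1
      field_simp
      norm_num
  exact (hg.memLp (2 * p)).mul' (hf.memLp (2 * p))

lemma Tame.conj (hf : Tame m P f) : Tame m P (fun ω => star (f ω)) := by
  refine ⟨continuous_star.measurable.comp hf.measurable, fun p => ?_⟩
  refine (hf.memLp p).of_le (continuous_star.comp_aestronglyMeasurable (hf.memLp p).1) ?_
  exact Filter.Eventually.of_forall fun ω => by simp

lemma tame_const [IsFiniteMeasure P] (c : ℂ) : Tame m P (fun _ => c) :=
  ⟨measurable_const, fun _ => memLp_const c⟩

lemma Tame.const_mul [IsFiniteMeasure P] (hf : Tame m P f) (c : ℂ) :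
    Tame m P (fun ω => c * f ω) :=
  (tame_const c).mul hf

lemma Tame.sum [IsFiniteMeasure P] {ι : Type*} {s : Finset ι} {f : ι → Ω → ℂ}
    (hf : ∀ i, Tame m P (f i)) : Tame m P (fun ω => ∑ i ∈ s, f i ω) := by
  classical
  induction s using Finset.induction_on with
  | empty => simpa using tame_const (m := m) (P := P) 0
  | insert a s ha ih =>
    simp only [Finset.sum_insert ha]
    exact (hf a).add ih

/-- The bound `√x ≤ 1 + x` shows that square roots preserve finiteness of all moments. -/
lemma Tame.sqrt [IsFiniteMeasure P] {ρ : Ω → ℝ} (hρ : Tame m P (fun ω => (ρ ω : ℂ))) :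
    Tame m P (fun ω => (Real.sqrt (ρ ω) : ℂ)) := by
  have hm : Measurable (fun z : ℂ => (Real.sqrt z.re : ℂ)) := by fun_prop
  have e : (fun ω => (Real.sqrt (ρ ω) : ℂ)) =
      (fun z : ℂ => (Real.sqrt z.re : ℂ)) ∘ fun ω => (ρ ω : ℂ) := by
    ext ω; simp
  refine ⟨by rw [e]; exact hm.comp hρ.measurable, fun p => ?_⟩
  have h1 : MemLp (fun ω => 1 + ‖(ρ ω : ℂ)‖) p P := (memLp_const (1 : ℝ)).add (hρ.memLp p).norm
  refine h1.of_le ?_ (Filter.Eventually.of_forall fun ω => ?_)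
  · rw [e]
    exact (hm.comp_aemeasurable (hρ.memLp p).1.aemeasurable).aestronglyMeasurable
  · have h3 : Real.sqrt (ρ ω) ≤ 1 + |ρ ω| := by
      rw [Real.sqrt_le_left (by positivity)]
      nlinarith [le_abs_self (ρ ω), abs_nonneg (ρ ω)]
    simp only [Complex.norm_real, Real.norm_eq_abs]
    rw [abs_of_nonneg (Real.sqrt_nonneg _), abs_of_nonneg (by positivity : 0 ≤ 1 + |ρ ω|)]
    exact h3

lemma Tame.integral_mul (hi : Indep m₁ m₂ P) (hf : Tame m₁ P f)
    (hg : Tame m₂ P g) : ∫ ω, f ω * g ω ∂P = (∫ ω, f ω ∂P) * ∫ ω, g ω ∂P :=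
  IndepFun.integral_fun_mul_eq_mul_integral
    (indep_of_indep_of_le hi hf.measurable.comap_le hg.measurable.comap_le)
    hf.integrable.1 hg.integrable.1

/-- If `U` has law `μ`, a measurable function of `U` with finite moments under `μ` is tame. -/
lemma tame_comp_of_hasLaw {𝓤 : Type*} {mU : MeasurableSpace 𝓤} {μ : Measure 𝓤} {U : Ω → 𝓤}
    (hU : HasLaw U μ P) {F : 𝓤 → ℂ} (hF : Tame mU μ F) :
    Tame (mU.comap U) P (fun ω => F (U ω)) := by
  refine ⟨hF.measurable.comp (comap_measurable U), fun p => ?_⟩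
  have h := hF.memLp p
  rw [← hU.map_eq] at h
  exact h.comp_of_map hU.aemeasurable

lemma Tame.integral_sum [IsFiniteMeasure P] {ι : Type*} {s : Finset ι} {f : ι → Ω → ℂ}
    (hf : ∀ i, Tame m P (f i)) : ∫ ω, ∑ i ∈ s, f i ω ∂P = ∑ i ∈ s, ∫ ω, f i ω ∂P :=
  integral_finsetSum _ fun i _ => (hf i).integrable

lemma Tame.integral_sum_sum [IsFiniteMeasure P] {ι κ : Type*} {s : Finset ι} {t : Finset κ}
    {f : ι → κ → Ω → ℂ} (hf : ∀ i j, Tame m P (f i j)) :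
    ∫ ω, ∑ i ∈ s, ∑ j ∈ t, f i j ω ∂P = ∑ i ∈ s, ∑ j ∈ t, ∫ ω, f i j ω ∂P := by
  rw [Tame.integral_sum fun i => Tame.sum (hf i)]
  exact Finset.sum_congr rfl fun i _ => Tame.integral_sum (hf i)

lemma integral_norm_sq (f : Ω → ℂ) :
    ((∫ ω, ‖f ω‖ ^ 2 ∂P : ℝ) : ℂ) = ∫ ω, f ω * star (f ω) ∂P := by
  refine integral_ofReal.symm.trans ?_
  congr 1 with ω
  simp [Complex.mul_conj, Complex.normSq_eq_norm_sq]

end Tame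

/-! ### White families -/

/-- A finite family of centred, mutually uncorrelated complex random variables with variances `γ`,
all of them tame with respect to `m`. -/
structure White {Ω ι : Type*} [DecidableEq ι] (m : MeasurableSpace Ω)
    {m₀ : MeasurableSpace Ω} (P : Measure Ω) (g : ι → Ω → ℂ) (γ : ι → ℂ) : Prop where
  tame : ∀ a, Tame m P (g a)
  mean : ∀ a, ∫ ω, g a ω ∂P = 0
  cov : ∀ a b, ∫ ω, g a ω * star (g b ω) ∂P = if a = b then γ a else 0

section White

variable {Ω ι κ : Type*} [DecidableEq ι] [DecidableEq κ] {m m' m₁ m₂ m₀ : MeasurableSpace Ω}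
  {P : Measure Ω} {g : ι → Ω → ℂ} {γ : ι → ℂ} {g' : κ → Ω → ℂ} {γ' : κ → ℂ}

lemma integral_star (f : Ω → ℂ) : ∫ ω, star (f ω) ∂P = star (∫ ω, f ω ∂P) :=
  integral_conj

lemma White.mono (hg : White m P g γ) (h : m ≤ m') : White m' P g γ :=
  ⟨fun a => (hg.tame a).mono h, hg.mean, hg.cov⟩

lemma White.sumElim (hg : White m₁ P g γ) (hg' : White m₂ P g' γ')
    (hi : Indep m₁ m₂ P) (h₁ : m₁ ≤ m') (h₂ : m₂ ≤ m') :
    White m' P (Sum.elim g g') (Sum.elim γ γ') := by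
  refine ⟨?_, ?_, ?_⟩
  · rintro (a | a)
    · exact (hg.tame a).mono h₁
    · exact (hg'.tame a).mono h₂
  · rintro (a | a)
    · exact hg.mean a
    · exact hg'.mean a
  · rintro (a | a) (b | b)
    · simpa using hg.cov a b
    · simp only [Sum.elim_inl, Sum.elim_inr,
        Tame.integral_mul hi (hg.tame a) (hg'.tame b).conj, hg.mean]
      simp
    · simp only [Sum.elim_inl, Sum.elim_inr,
        Tame.integral_mul hi.symm (hg'.tame a) (hg.tame b).conj, hg'.mean]
      simp
    · simpa using hg'.cov a b

variable [IsFiniteMeasure P]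

lemma White.tame_affine [Fintype ι] (hg : White m₂ P g γ) (h₁ : m₁ ≤ m')
    (h₂ : m₂ ≤ m') {x₀ : Ω → ℂ} {x : ι → Ω → ℂ} (hx₀ : Tame m₁ P x₀)
    (hx : ∀ a, Tame m₁ P (x a)) : Tame m' P (fun ω => x₀ ω + ∑ a, x a ω * g a ω) :=
  (hx₀.mono h₁).add (Tame.sum fun a => ((hx a).mono h₁).mul ((hg.tame a).mono h₂))

/-- Covariance of two random variables that are affine in a white family, with coefficients
independent of that family: only the diagonal terms survive. This is conditioning on the
coefficients, followed by taking expectations. -/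
theorem White.integral_mul_star [Fintype ι] (hg : White m₂ P g γ) (hi : Indep m₁ m₂ P)
    {x₀ y₀ : Ω → ℂ} {x y : ι → Ω → ℂ} (hx₀ : Tame m₁ P x₀) (hx : ∀ a, Tame m₁ P (x a))
    (hy₀ : Tame m₁ P y₀) (hy : ∀ a, Tame m₁ P (y a)) :
    ∫ ω, (x₀ ω + ∑ a, x a ω * g a ω) * star (y₀ ω + ∑ a, y a ω * g a ω) ∂P
      = ∫ ω, x₀ ω * star (y₀ ω) ∂P + ∑ a, γ a * ∫ ω, x a ω * star (y a ω) ∂P := by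
  have l₁ : m₁ ≤ m₁ ⊔ m₂ := le_sup_left
  have l₂ : m₂ ≤ m₁ ⊔ m₂ := le_sup_right
  have e : ∀ ω, (x₀ ω + ∑ a, x a ω * g a ω) * star (y₀ ω + ∑ a, y a ω * g a ω)
      = x₀ ω * star (y₀ ω) + ∑ b, (x₀ ω * star (y b ω)) * star (g b ω)
        + ∑ a, (x a ω * star (y₀ ω)) * g a ω
        + ∑ a, ∑ b, (x a ω * star (y b ω)) * (g a ω * star (g b ω)) := by
    intro ω
    rw [star_add, star_sum]
    simp only [star_mul']
    rw [add_mul, mul_add, mul_add, Finset.sum_mul_sum, Finset.mul_sum, Finset.sum_mul]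
    have e1 : ∀ b, x₀ ω * (star (y b ω) * star (g b ω)) = x₀ ω * star (y b ω) * star (g b ω) :=
      fun b => by ring
    have e2 : ∀ a, x a ω * g a ω * star (y₀ ω) = x a ω * star (y₀ ω) * g a ω := fun a => by ring
    have e3 : ∀ a b, x a ω * g a ω * (star (y b ω) * star (g b ω))
      = x a ω * star (y b ω) * (g a ω * star (g b ω)) := fun a b => by ring
    simp only [e1, e2, e3]
    ring
  have t0 : Tame (m₁ ⊔ m₂) P (fun ω => x₀ ω * star (y₀ ω)) := (hx₀.mul hy₀.conj).mono l₁
  have t1 : ∀ b, Tame (m₁ ⊔ m₂) P (fun ω => (x₀ ω * star (y b ω)) * star (g b ω)) := fun b =>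
    ((hx₀.mul (hy b).conj).mono l₁).mul ((hg.tame b).conj.mono l₂)
  have t2 : ∀ a, Tame (m₁ ⊔ m₂) P (fun ω => (x a ω * star (y₀ ω)) * g a ω) := fun b =>
    (((hx b).mul hy₀.conj).mono l₁).mul ((hg.tame b).mono l₂)
  have t3 : ∀ a b, Tame (m₁ ⊔ m₂) P
      (fun ω => (x a ω * star (y b ω)) * (g a ω * star (g b ω))) := fun a b =>
    (((hx a).mul (hy b).conj).mono l₁).mul (((hg.tame a).mul (hg.tame b).conj).mono l₂)
  simp only [e]
  rw [integral_add ((t0.add (Tame.sum t1)).add (Tame.sum t2)).integrable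
      (Tame.sum fun a => Tame.sum (t3 a)).integrable,
    integral_add (t0.add (Tame.sum t1)).integrable (Tame.sum t2).integrable,
    integral_add t0.integrable (Tame.sum t1).integrable,
    integral_finsetSum _ fun b _ => (t1 b).integrable,
    integral_finsetSum _ fun b _ => (t2 b).integrable,
    integral_finsetSum _ fun b _ => (Tame.sum (t3 b)).integrable]
  have z1 : ∀ b, ∫ ω, (x₀ ω * star (y b ω)) * star (g b ω) ∂P = 0 := fun b => by
    rw [Tame.integral_mul hi (hx₀.mul (hy b).conj) (hg.tame b).conj, integral_star, hg.mean]
    simp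
  have z2 : ∀ a, ∫ ω, (x a ω * star (y₀ ω)) * g a ω ∂P = 0 := fun b => by
    rw [Tame.integral_mul hi ((hx b).mul hy₀.conj) (hg.tame b), hg.mean]
    simp
  have z3 : ∀ a, ∫ ω, ∑ b, (x a ω * star (y b ω)) * (g a ω * star (g b ω)) ∂P
      = γ a * ∫ ω, x a ω * star (y a ω) ∂P := fun a => by
    rw [integral_finsetSum _ fun b _ => (t3 a b).integrable]
    simp only [fun b => Tame.integral_mul hi ((hx a).mul (hy b).conj)
      ((hg.tame a).mul (hg.tame b).conj), hg.cov]
    simp [mul_comm]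
  simp only [z1, z2, z3, Finset.sum_const_zero, add_zero]

/-- The mean of a random variable that is affine in a white family with independent coefficients. -/
theorem White.integral_affine [Fintype ι] (hg : White m₂ P g γ) (hi : Indep m₁ m₂ P)
    {x₀ : Ω → ℂ} {x : ι → Ω → ℂ} (hx₀ : Tame m₁ P x₀) (hx : ∀ a, Tame m₁ P (x a)) :
    ∫ ω, (x₀ ω + ∑ a, x a ω * g a ω) ∂P = ∫ ω, x₀ ω ∂P := by
  have := hg.integral_mul_star hi hx₀ hx (y₀ := fun _ => 1) (y := fun _ _ => 0)
    (tame_const 1) (fun _ => tame_const 0)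
  simpa using this

/-- Linear combinations of the rows of a white family indexed by a product form a white family. -/
lemma White.combine [Fintype κ] {g : κ × ι → Ω → ℂ} {v : ℂ} (hg : White m P g fun _ => v)
    (c : κ → ℂ) :
    White m P (fun a ω => ∑ j, c j * g (j, a) ω) fun _ => v * ∑ j, c j * star (c j) := by
  refine ⟨fun a => Tame.sum fun j => (hg.tame (j, a)).const_mul _, fun a => ?_, fun a b => ?_⟩
  · rw [integral_finsetSum _ fun j _ => ((hg.tame (j, a)).const_mul _).integrable]
    simp [integral_const_mul, hg.mean]
  · have e : ∀ ω, (∑ j, c j * g (j, a) ω) * star (∑ j, c j * g (j, b) ω)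
        = ∑ j, ∑ l, (c j * star (c l)) * (g (j, a) ω * star (g (l, b) ω)) := fun ω => by
      rw [star_sum, Finset.sum_mul_sum]
      refine Finset.sum_congr rfl fun j _ => Finset.sum_congr rfl fun l _ => ?_
      rw [star_mul']
      ring
    have t : ∀ j l, Tame m P (fun ω => (c j * star (c l)) * (g (j, a) ω * star (g (l, b) ω))) :=
      fun j l => ((hg.tame _).mul (hg.tame _).conj).const_mul _
    simp only [e]
    rw [integral_finsetSum _ fun j _ => (Tame.sum (t j)).integrable]
    simp only [fun j => integral_finsetSum Finset.univ fun l _ => (t j l).integrable,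
      integral_const_mul, hg.cov, Prod.mk.injEq]
    by_cases hab : a = b
    · simp [hab, Finset.mul_sum, mul_comm]
    · simp [hab]

end White

/-! ### Moments of complex Gaussian vectors -/

lemma integral_pow_two_gaussianReal (v : ℝ≥0) : ∫ x, x ^ 2 ∂gaussianReal 0 v = v := by
  have h := variance_fun_id_gaussianReal (μ := 0) (v := v)
  rw [variance_eq_integral measurable_id'.aemeasurable] at h
  simpa using h

/-- The fourth moment is the fourth derivative of the moment generating function at `0`. -/
lemma integral_pow_four_gaussianReal (v : ℝ≥0) :
    ∫ x, x ^ 4 ∂gaussianReal 0 v = 3 * (v : ℝ) ^ 2 := by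
  have h0 : ∫ x, x ^ 4 ∂gaussianReal 0 v =
      iteratedDeriv 4 (mgf (fun x => x) (gaussianReal 0 v)) 0 := by
    rw [iteratedDeriv_mgf_zero] <;> simp
  have hE : ∀ t : ℝ, HasDerivAt (fun t : ℝ => Real.exp (v * t ^ 2 / 2))
      (v * t * Real.exp (v * t ^ 2 / 2)) t := by
    intro t
    have := ((((hasDerivAt_id t).pow 2).const_mul (v : ℝ)).div_const 2).exp
    refine this.congr_deriv ?_
    simp
    ring
  have d1 : deriv (fun t : ℝ => Real.exp (v * t ^ 2 / 2)) =
      fun t => v * t * Real.exp (v * t ^ 2 / 2) := funext fun t => (hE t).deriv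
  have d2 : deriv (fun t : ℝ => v * t * Real.exp (v * t ^ 2 / 2)) =
      fun t => (v + v ^ 2 * t ^ 2) * Real.exp (v * t ^ 2 / 2) := funext fun t => by
    have := ((hasDerivAt_id t).const_mul (v : ℝ)).mul (hE t)
    refine (this.congr_deriv ?_).deriv
    simp
    ring
  have d3 : deriv (fun t : ℝ => (v + v ^ 2 * t ^ 2) * Real.exp (v * t ^ 2 / 2)) =
      fun t => (3 * v ^ 2 * t + v ^ 3 * t ^ 3) * Real.exp (v * t ^ 2 / 2) := funext fun t => by
    have := ((((hasDerivAt_id t).pow 2).const_mul ((v : ℝ) ^ 2)).const_add (v : ℝ)).mul (hE t)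
    refine (this.congr_deriv ?_).deriv
    simp
    ring
  have d4 : deriv (fun t : ℝ => (3 * v ^ 2 * t + v ^ 3 * t ^ 3) * Real.exp (v * t ^ 2 / 2)) 0 =
      3 * (v : ℝ) ^ 2 := by
    have : HasDerivAt
        (fun t : ℝ => (3 * v ^ 2 * t + v ^ 3 * t ^ 3) * Real.exp (v * t ^ 2 / 2)) _ 0 :=
      (((hasDerivAt_id (0 : ℝ)).const_mul (3 * (v : ℝ) ^ 2)).add
      (((hasDerivAt_id (0 : ℝ)).pow 3).const_mul ((v : ℝ) ^ 3))).mul (hE 0)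
    refine (this.congr_deriv ?_).deriv
    simp
  rw [h0, mgf_fun_id_gaussianReal, iteratedDeriv_succ, iteratedDeriv_succ, iteratedDeriv_succ,
    iteratedDeriv_one]
  simp only [zero_mul, zero_add]
  rw [d1, d2, d3, d4]

lemma measurable_mk : Measurable (fun x : ℝ × ℝ => (⟨x.1, x.2⟩ : ℂ)) :=
  Complex.measurableEquivRealProd.symm.measurable

instance : IsProbabilityMeasure stdComplexGaussian :=
  Measure.isProbabilityMeasure_map measurable_mk.aemeasurable

instance {M : ℕ} (C : Matrix (Fin M) (Fin M) ℂ) : IsProbabilityMeasure (complexGaussian C) :=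
  Measure.isProbabilityMeasure_map (by fun_prop)

lemma tame_stdComplexGaussian : Tame inferInstance stdComplexGaussian (fun z : ℂ => z) := by
  refine ⟨measurable_id, fun p => ?_⟩
  refine (memLp_map_measure_iff aestronglyMeasurable_id measurable_mk.aemeasurable).2 ?_
  have h1 := ((memLp_id_gaussianReal (μ := 0) (v := 1 / 2) p).comp_measurePreserving
    (measurePreserving_fst (μ := gaussianReal 0 (1 / 2))
      (ν := gaussianReal 0 (1 / 2)))).ofReal (K := ℂ)
  have h2 := ((memLp_id_gaussianReal (μ := 0) (v := 1 / 2) p).comp_measurePreserving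
    (measurePreserving_snd (μ := gaussianReal 0 (1 / 2))
      (ν := gaussianReal 0 (1 / 2)))).ofReal (K := ℂ)
  refine (h1.add (h2.const_mul Complex.I)).congr_norm ?_ ?_
  · exact measurable_mk.aestronglyMeasurable
  · refine Filter.Eventually.of_forall fun x => ?_
    congr 1
    apply Complex.ext <;> simp

/-- Circular symmetry: the standard complex Gaussian law is invariant under a quarter turn. -/
lemma stdComplexGaussian_map_I_mul :
    stdComplexGaussian.map (fun z => Complex.I * z) = stdComplexGaussian := by
  have hneg : MeasurePreserving (fun x : ℝ => -x) (gaussianReal 0 (1 / 2))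
      (gaussianReal 0 (1 / 2)) :=
    ⟨measurable_neg, by simpa using gaussianReal_map_neg (μ := 0) (v := 1 / 2)⟩
  have hp := (hneg.prod (MeasurePreserving.id (gaussianReal 0 (1 / 2)))).comp
    (Measure.measurePreserving_swap (μ := gaussianReal 0 (1 / 2)) (ν := gaussianReal 0 (1 / 2)))
  conv_rhs => rw [stdComplexGaussian, ← hp.map_eq, Measure.map_map measurable_mk hp.measurable]
  rw [stdComplexGaussian, Measure.map_map (by fun_prop) measurable_mk]
  congr 1
  ext x
  simp [Complex.ext_iff]

lemma integral_norm_pow_stdComplexGaussian :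
    ∫ z, ‖z‖ ^ 2 ∂stdComplexGaussian = 1 ∧ ∫ z, ‖z‖ ^ 4 ∂stdComplexGaussian = 2 := by
  have hint : ∀ n : ℕ, Integrable (fun x : ℝ => x ^ n) (gaussianReal 0 (1 / 2)) := fun n => by
    rcases Nat.eq_zero_or_pos n with rfl | hn
    · simp
    have := (memLp_id_gaussianReal (μ := 0) (v := 1 / 2) n).integrable_norm_pow (by omega)
    refine this.mono (by fun_prop) (Filter.Eventually.of_forall fun x => by simp)
  have i1 : ∀ n, Integrable (fun x : ℝ × ℝ => x.1 ^ n)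
      ((gaussianReal 0 (1 / 2)).prod (gaussianReal 0 (1 / 2))) := fun n => (hint n).comp_fst _
  have i2 : ∀ n, Integrable (fun x : ℝ × ℝ => x.2 ^ n)
      ((gaussianReal 0 (1 / 2)).prod (gaussianReal 0 (1 / 2))) := fun n => (hint n).comp_snd _
  have i3 : Integrable (fun x : ℝ × ℝ => x.1 ^ 2 * x.2 ^ 2)
      ((gaussianReal 0 (1 / 2)).prod (gaussianReal 0 (1 / 2))) := (hint 2).mul_prod (hint 2)
  have e1 : ∀ n, ∫ x : ℝ × ℝ, x.1 ^ n ∂((gaussianReal 0 (1 / 2)).prod (gaussianReal 0 (1 / 2)))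
      = ∫ x, x ^ n ∂gaussianReal 0 (1 / 2) := fun n => by
    simpa using integral_fun_fst (μ := gaussianReal 0 (1 / 2)) (ν := gaussianReal 0 (1 / 2))
      (fun x : ℝ => x ^ n)
  have e2 : ∀ n, ∫ x : ℝ × ℝ, x.2 ^ n ∂((gaussianReal 0 (1 / 2)).prod (gaussianReal 0 (1 / 2)))
      = ∫ x, x ^ n ∂gaussianReal 0 (1 / 2) := fun n => by
    simpa using integral_fun_snd (μ := gaussianReal 0 (1 / 2)) (ν := gaussianReal 0 (1 / 2))
      (fun x : ℝ => x ^ n)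
  have hn : ∀ x : ℝ × ℝ, ‖(⟨x.1, x.2⟩ : ℂ)‖ ^ 2 = x.1 ^ 2 + x.2 ^ 2 := fun x => by
    rw [← Complex.normSq_eq_norm_sq, Complex.normSq_mk]
    ring
  constructor
  · rw [stdComplexGaussian, integral_map measurable_mk.aemeasurable (by fun_prop)]
    simp only [hn]
    rw [integral_add (i1 2) (i2 2), e1, e2, integral_pow_two_gaussianReal]
    norm_num
  · rw [stdComplexGaussian, integral_map measurable_mk.aemeasurable (by fun_prop)]
    have : ∀ x : ℝ × ℝ, ‖(⟨x.1, x.2⟩ : ℂ)‖ ^ 4 = x.1 ^ 4 + 2 * (x.1 ^ 2 * x.2 ^ 2) + x.2 ^ 4 :=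
      fun x => by
        rw [show (4 : ℕ) = 2 * 2 from rfl, pow_mul, hn]
        ring
    have i13 : Integrable (fun x : ℝ × ℝ => x.1 ^ 4 + 2 * (x.1 ^ 2 * x.2 ^ 2))
        ((gaussianReal 0 (1 / 2)).prod (gaussianReal 0 (1 / 2))) := (i1 4).add (i3.const_mul 2)
    simp only [this]
    rw [integral_add i13 (i2 4), integral_add (i1 4) (i3.const_mul 2),
      integral_const_mul, integral_prod_mul (fun x : ℝ => x ^ 2) (fun x : ℝ => x ^ 2), e1, e2,
      integral_pow_two_gaussianReal, integral_pow_four_gaussianReal]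
    norm_num

/-- Mixed moments `E z^a (z^*)^b` of a standard complex Gaussian. Those with `a ≠ b` vanish by
circular symmetry; a quarter turn detects this because `|a - b| < 4`. -/
lemma integral_mixed_stdComplexGaussian (a b : ℕ) (ha : a ≤ 2) (hb : b ≤ 2) :
    ∫ z, z ^ a * star z ^ b ∂stdComplexGaussian = if a = b then (a.factorial : ℂ) else 0 := by
  have hrot : ∫ z, z ^ a * star z ^ b ∂stdComplexGaussian =
      (Complex.I ^ a * star Complex.I ^ b) * ∫ z, z ^ a * star z ^ b ∂stdComplexGaussian := by
    conv_lhs => rw [← stdComplexGaussian_map_I_mul]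
    rw [integral_map (by fun_prop) (by fun_prop), ← integral_const_mul]
    congr 1 with z
    rw [star_mul', mul_pow, mul_pow]
    ring
  have hdiag : ∀ n : ℕ, ∫ z, z ^ n * star z ^ n ∂stdComplexGaussian
      = ((∫ z, ‖z‖ ^ (2 * n) ∂stdComplexGaussian : ℝ) : ℂ) := fun n => by
    refine Eq.trans ?_ integral_ofReal
    congr 1 with z
    rw [← mul_pow, Complex.star_def, Complex.mul_conj, Complex.normSq_eq_norm_sq]
    simp [pow_mul]
  obtain ⟨h2, h4⟩ := integral_norm_pow_stdComplexGaussian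
  have key : ∀ c x : ℂ, c ≠ 1 → x = c * x → x = 0 := fun c x hc hx => by
    have : (1 - c) * x = 0 := by linear_combination hx
    rcases mul_eq_zero.1 this with h | h
    · exact absurd (by linear_combination -h) hc
    · exact h
  interval_cases a <;> interval_cases b
  · simp
  · refine key _ _ ?_ hrot; simp [Complex.ext_iff]
  · refine key _ _ ?_ hrot; simp [Complex.ext_iff]; norm_num
  · refine key _ _ ?_ hrot; simp [Complex.ext_iff]
  · rw [hdiag]; simp [h2]
  · refine key _ _ ?_ hrot; simp [Complex.ext_iff, pow_two]
  · refine key _ _ ?_ hrot; simp [Complex.ext_iff]; norm_num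
  · refine key _ _ ?_ hrot; simp [Complex.ext_iff, pow_two]
  · rw [hdiag]; simp [h4]

section StdVector

variable {ι : Type*} [Fintype ι]

lemma tame_eval_pi_stdComplexGaussian (α : ι) :
    Tame inferInstance (Measure.pi fun _ : ι => stdComplexGaussian) (fun g => g α) :=
  ⟨measurable_pi_apply α, fun p => (tame_stdComplexGaussian.memLp p).comp_measurePreserving
    (measurePreserving_eval (fun _ : ι => stdComplexGaussian) α)⟩

lemma integral_monomial_pi_stdComplexGaussian (a b : ι → ℕ) (ha : ∀ i, a i ≤ 2)
    (hb : ∀ i, b i ≤ 2) :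
    ∫ g, (∏ i, g i ^ a i) * ∏ i, star (g i) ^ b i ∂(Measure.pi fun _ : ι => stdComplexGaussian)
      = ∏ i, if a i = b i then ((a i).factorial : ℂ) else 0 := by
  simp only [← Finset.prod_mul_distrib]
  rw [integral_fintype_prod_eq_prod (fun i (z : ℂ) => z ^ a i * star z ^ b i)]
  exact Finset.prod_congr rfl fun i _ => integral_mixed_stdComplexGaussian _ _ (ha i) (hb i)

variable [DecidableEq ι]

lemma prod_pow_ite (f : ι → ℂ) (α : ι) : ∏ i, f i ^ (if i = α then 1 else 0) = f α := by
  rw [Finset.prod_eq_single α (fun i _ hi => by simp [hi]) (by simp)]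
  simp

lemma white_pi_stdComplexGaussian :
    White inferInstance (Measure.pi fun _ : ι => stdComplexGaussian) (fun α g => g α)
      (fun _ => 1) := by
  refine ⟨tame_eval_pi_stdComplexGaussian, fun α => ?_, fun α β => ?_⟩
  · have h := integral_monomial_pi_stdComplexGaussian (fun i => if i = α then 1 else 0)
      (fun _ => 0) (fun i => by split <;> omega) (fun i => by omega)
    have : (∏ i, if (if i = α then 1 else 0) = 0 then
        (((if i = α then 1 else 0 : ℕ).factorial : ℕ) : ℂ) else 0) = 0 :=
      Finset.prod_eq_zero (Finset.mem_univ α) (by simp)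
    rw [this] at h
    simpa [prod_pow_ite] using h
  · have h := integral_monomial_pi_stdComplexGaussian (fun i => if i = α then 1 else 0)
      (fun i => if i = β then 1 else 0) (fun i => by split <;> omega) (fun i => by split <;> omega)
    simp only [prod_pow_ite] at h
    rw [h]
    split_ifs with hαβ
    · subst hαβ
      exact Finset.prod_eq_one fun i _ => by by_cases hi : i = α <;> simp [hi]
    · exact Finset.prod_eq_zero (Finset.mem_univ α) (by simp [hαβ])

/-- Fourth-order moments of independent standard complex Gaussians (Isserlis' formula): only
pairings of an entry with a conjugated one contribute. -/
lemma integral_four_pi_stdComplexGaussian (α β γ δ : ι) :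
    ∫ g, (g α * star (g β)) * (g γ * star (g δ)) ∂(Measure.pi fun _ : ι => stdComplexGaussian)
      = (if α = β then 1 else 0) * (if γ = δ then 1 else 0)
        + (if α = δ then 1 else 0) * (if γ = β then 1 else 0) := by
  have h := integral_monomial_pi_stdComplexGaussian
    (fun i => (if i = α then 1 else 0) + (if i = γ then 1 else 0))
    (fun i => (if i = β then 1 else 0) + (if i = δ then 1 else 0))
    (fun i => by split <;> split <;> omega) (fun i => by split <;> split <;> omega)
  simp only [pow_add, Finset.prod_mul_distrib, prod_pow_ite] at h
  have e : ∀ g : ι → ℂ, (g α * star (g β)) * (g γ * star (g δ)) =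
      g α * g γ * (star (g β) * star (g δ)) := fun g => by ring
  simp only [e]
  rw [h]
  -- the product of factorials `∏ᵢ aᵢ!` when the multi-index `a` is the sum of two unit indices
  have hfac : ∏ i, ((((if i = α then 1 else 0) + (if i = γ then 1 else 0) : ℕ).factorial : ℕ) : ℂ)
      = 1 + if α = γ then 1 else 0 := by
    by_cases hαγ : α = γ
    · subst hαγ
      rw [Finset.prod_eq_single α (fun i _ hi => by simp [hi]) (by simp)]
      norm_num
    · rw [if_neg hαγ, add_zero]
      refine Finset.prod_eq_one fun i _ => ?_
      by_cases h1 : i = α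
      · have : i ≠ γ := fun h2 => hαγ (h1.symm.trans h2)
        simp [h1, hαγ]
      · by_cases h2 : i = γ
        · simp [h2, Ne.symm hαγ]
        · simp [h1, h2]
  by_cases hαβ : α = β
  · subst hαβ
    by_cases hγδ : γ = δ
    · subst hγδ
      simp only [if_true, hfac]
      by_cases hαγ : α = γ <;> simp [hαγ]
    · have hRHS : ¬ (α = δ ∧ γ = α) := fun h => hγδ (h.2.trans h.1)
      rw [Finset.prod_eq_zero (Finset.mem_univ γ) (by simp [hγδ])]
      by_cases h1 : α = δ <;> simp_all
  · by_cases h2 : α = δ ∧ γ = β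
    · obtain ⟨rfl, rfl⟩ := h2
      have : ∀ i, ((if i = α then 1 else 0) + (if i = γ then 1 else 0) : ℕ) =
        (if i = γ then 1 else 0) + (if i = α then 1 else 0) := fun i => add_comm _ _
      simp only [this, if_true]
      simp only [← this, hfac]
      simp [hαβ]
    · have hz : (∏ i, if ((if i = α then 1 else 0) + (if i = γ then 1 else 0) : ℕ) =
          (if i = β then 1 else 0) + (if i = δ then 1 else 0) then
          ((((if i = α then 1 else 0) + (if i = γ then 1 else 0) : ℕ).factorial : ℕ) : ℂ) else 0)
          = 0 := by
        by_cases h3 : α = δ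
        · refine Finset.prod_eq_zero (Finset.mem_univ β) ?_
          have h4 : γ ≠ β := fun h => h2 ⟨h3, h⟩
          simp [← h3, Ne.symm hαβ, Ne.symm h4]
        · exact Finset.prod_eq_zero (Finset.mem_univ α) (by simp [hαβ, h3])
      rw [hz]
      by_cases h3 : α = δ <;> simp_all

end StdVector

section Vector

variable {M : ℕ} {C : Matrix (Fin M) (Fin M) ℂ}

lemma sum_sqrt_mul_star_sqrt (hC : C.PosSemidef) (a b : Fin M) :
    ∑ α, CFC.sqrt C a α * star (CFC.sqrt C b α) = C a b := by
  have hS : (CFC.sqrt C)ᴴ = CFC.sqrt C :=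
    (Matrix.nonneg_iff_posSemidef.1 (CFC.sqrt_nonneg C)).1
  have h2 : CFC.sqrt C * (CFC.sqrt C)ᴴ = C := by
    rw [hS]
    exact CFC.sqrt_mul_sqrt_self C (Matrix.nonneg_iff_posSemidef.2 hC)
  conv_rhs => rw [← h2, Matrix.mul_apply]
  simp only [Matrix.conjTranspose_apply]

lemma mulVec_apply_eq_sum (S : Matrix (Fin M) (Fin M) ℂ) (g : Fin M → ℂ) (a : Fin M) :
    (S *ᵥ g) a = ∑ α, S a α * g α :=
  rfl

lemma tame_mulVec {Ω : Type*} {m m₀ : MeasurableSpace Ω} {P : Measure Ω} [IsFiniteMeasure P]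
    {h : Ω → Fin M → ℂ} (hh : ∀ a, Tame m P (fun ω => h ω a)) (S : Matrix (Fin M) (Fin M) ℂ)
    (a : Fin M) : Tame m P (fun ω => (S *ᵥ h ω) a) := by
  simp only [mulVec_apply_eq_sum]
  exact Tame.sum fun α => (hh α).const_mul _

lemma measurable_mulVec (S : Matrix (Fin M) (Fin M) ℂ) :
    Measurable (fun g : Fin M → ℂ => S *ᵥ g) := by
  fun_prop

lemma integral_complexGaussian {F : (Fin M → ℂ) → ℂ} (hF : Measurable F) :
    ∫ h, F h ∂complexGaussian C =
      ∫ g, F (CFC.sqrt C *ᵥ g) ∂(Measure.pi fun _ : Fin M => stdComplexGaussian) :=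
  integral_map (measurable_mulVec _).aemeasurable hF.aestronglyMeasurable

lemma tame_eval_complexGaussian (a : Fin M) :
    Tame inferInstance (complexGaussian C) (fun h => h a) := by
  refine ⟨measurable_pi_apply a, fun p => ?_⟩
  exact (memLp_map_measure_iff (measurable_pi_apply a).aestronglyMeasurable
    (measurable_mulVec _).aemeasurable).2
    ((tame_mulVec tame_eval_pi_stdComplexGaussian (CFC.sqrt C) a).memLp p)

lemma integral_eval_complexGaussian (a : Fin M) : ∫ h, h a ∂complexGaussian C = 0 := by
  rw [integral_complexGaussian (by fun_prop)]
  have := white_pi_stdComplexGaussian.integral_affine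
    (indep_bot_left (inferInstance : MeasurableSpace (Fin M → ℂ)))
    (x₀ := fun _ => 0) (x := fun α _ => CFC.sqrt C a α) (tame_const 0) (fun _ => tame_const _)
  simpa [mulVec_apply_eq_sum] using this

lemma integral_two_complexGaussian (hC : C.PosSemidef) (a b : Fin M) :
    ∫ h, h a * star (h b) ∂complexGaussian C = C a b := by
  rw [integral_complexGaussian (by fun_prop)]
  have := white_pi_stdComplexGaussian.integral_mul_star
    (indep_bot_left (inferInstance : MeasurableSpace (Fin M → ℂ)))
    (x₀ := fun _ => 0) (x := fun α _ => CFC.sqrt C a α) (y₀ := fun _ => 0)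
    (y := fun α _ => CFC.sqrt C b α) (tame_const 0) (fun _ => tame_const _)
    (tame_const 0) (fun _ => tame_const _)
  rw [← sum_sqrt_mul_star_sqrt hC]
  simpa [mulVec_apply_eq_sum] using this

/-- Fourth-order moments of the linear image `S g` of a standard complex Gaussian vector `g`. -/
lemma integral_four_mulVec (S : Matrix (Fin M) (Fin M) ℂ) (a b c d : Fin M) :
    ∫ g, ((S *ᵥ g) a * star ((S *ᵥ g) b)) * ((S *ᵥ g) c * star ((S *ᵥ g) d))
        ∂(Measure.pi fun _ : Fin M => stdComplexGaussian)
      = (∑ α, S a α * star (S b α)) * (∑ α, S c α * star (S d α))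
        + (∑ α, S a α * star (S d α)) * ∑ α, S c α * star (S b α) := by
  have e : ∀ g : Fin M → ℂ, ((S *ᵥ g) a * star ((S *ᵥ g) b)) * ((S *ᵥ g) c * star ((S *ᵥ g) d))
      = ∑ α, ∑ β, ∑ γ, ∑ δ, (S a α * star (S b β) * (S c γ * star (S d δ))) *
          ((g α * star (g β)) * (g γ * star (g δ))) := fun g => by
    simp only [mulVec_apply_eq_sum, star_sum, star_mul', Finset.sum_mul_sum]
    refine Finset.sum_congr rfl fun α _ => ?_
    rw [Finset.sum_comm]
    refine Finset.sum_congr rfl fun β _ =>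
      Finset.sum_congr rfl fun γ _ => Finset.sum_congr rfl fun δ _ => ?_
    ring
  have t : ∀ α β γ δ, Tame inferInstance (Measure.pi fun _ : Fin M => stdComplexGaussian)
      (fun g => (S a α * star (S b β) * (S c γ * star (S d δ))) *
          ((g α * star (g β)) * (g γ * star (g δ)))) := fun α β γ δ =>
    (((tame_eval_pi_stdComplexGaussian α).mul (tame_eval_pi_stdComplexGaussian β).conj).mul
      ((tame_eval_pi_stdComplexGaussian γ).mul
        (tame_eval_pi_stdComplexGaussian δ).conj)).const_mul _
  simp only [e]
  rw [Tame.integral_sum_sum fun α β => Tame.sum fun γ => Tame.sum fun δ => t α β γ δ]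
  have t' : ∀ α β, ∫ g, ∑ γ, ∑ δ, (S a α * star (S b β) * (S c γ * star (S d δ))) *
          ((g α * star (g β)) * (g γ * star (g δ)))
          ∂(Measure.pi fun _ : Fin M => stdComplexGaussian)
      = ∑ γ, ∑ δ, (S a α * star (S b β) * (S c γ * star (S d δ))) *
          ((if α = β then 1 else 0) * (if γ = δ then 1 else 0)
            + (if α = δ then 1 else 0) * (if γ = β then 1 else 0)) := fun α β => by
    rw [Tame.integral_sum_sum (t α β)]
    simp only [integral_const_mul, integral_four_pi_stdComplexGaussian]
  simp only [t']
  simp only [mul_add, Finset.sum_add_distrib, Finset.sum_mul_sum]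
  congr 1
  · refine Finset.sum_congr rfl fun α _ => ?_
    rw [Finset.sum_eq_single α (fun β _ hβ => by simp [Ne.symm hβ]) (by simp)]
    refine Finset.sum_congr rfl fun γ _ => ?_
    rw [Finset.sum_eq_single γ (fun δ _ hδ => by simp [Ne.symm hδ]) (by simp)]
    simp
  · refine Finset.sum_congr rfl fun α _ => Finset.sum_congr rfl fun β _ => ?_
    rw [Finset.sum_eq_single β (fun γ _ hγ => by simp [hγ]) (by simp),
      Finset.sum_eq_single α (fun δ _ hδ => by simp [Ne.symm hδ]) (by simp)]
    simp only [if_true, mul_one]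
    ring

/-- Isserlis' formula for the fourth-order moments of a circularly symmetric Gaussian vector. -/
theorem integral_four_complexGaussian (hC : C.PosSemidef) (a b c d : Fin M) :
    ∫ h, (h a * star (h b)) * (h c * star (h d)) ∂complexGaussian C
      = C a b * C c d + C a d * C c b := by
  rw [integral_complexGaussian (by fun_prop), integral_four_mulVec]
  simp only [sum_sqrt_mul_star_sqrt hC]

end Vector

/-! ### Moments of the signals of the uplink model -/

section Transfer

variable {Ω 𝓤 ι J : Type*} {m m₀ : MeasurableSpace Ω} {P : Measure Ω} {mU : MeasurableSpace 𝓤}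
  {μ : Measure 𝓤}

lemma integral_comp_of_hasLaw {U : Ω → 𝓤} (hU : HasLaw U μ P) {F : 𝓤 → ℂ}
    (hF : Tame mU μ F) : ∫ ω, F (U ω) ∂P = ∫ x, F x ∂μ :=
  hU.integral_comp hF.integrable.1

lemma White.comp_hasLaw [DecidableEq ι] {U : Ω → 𝓤} (hU : HasLaw U μ P) {g : ι → 𝓤 → ℂ} {γ : ι → ℂ}
    (hg : White mU μ g γ) : White (mU.comap U) P (fun a ω => g a (U ω)) γ := by
  refine ⟨fun a => tame_comp_of_hasLaw hU (hg.tame a), fun a => ?_, fun a b => ?_⟩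
  · rw [integral_comp_of_hasLaw hU (hg.tame a), hg.mean]
  · rw [integral_comp_of_hasLaw hU ((hg.tame a).mul (hg.tame b).conj), hg.cov]

lemma comap_eval_le (j : J) :
    (mU.comap fun x : J → 𝓤 => x j) ≤ (inferInstance : MeasurableSpace (J → 𝓤)) :=
  (measurable_pi_apply j).comap_le

variable [Fintype J] [IsProbabilityMeasure μ]

lemma tame_comp_eval {ν : J → Measure 𝓤} [∀ j, IsProbabilityMeasure (ν j)] (j : J) {F : 𝓤 → ℂ}
    (hF : Tame mU (ν j) F) :
    Tame (mU.comap fun x : J → 𝓤 => x j) (Measure.pi ν) (fun x => F (x j)) :=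
  tame_comp_of_hasLaw (measurePreserving_eval ν j).hasLaw hF

lemma integral_comp_eval_mul {ν : J → Measure 𝓤} [∀ j, IsProbabilityMeasure (ν j)] {i j : J}
    (hij : i ≠ j) {F G : 𝓤 → ℂ} (hF : Tame mU (ν i) F) (hG : Tame mU (ν j) G) :
    ∫ x, F (x i) * G (x j) ∂(Measure.pi ν) = (∫ x, F x ∂ν i) * ∫ x, G x ∂ν j := by
  have hi : IndepFun (fun x : J → 𝓤 => x i) (fun x => x j) (Measure.pi ν) :=
    (iIndepFun_pi (X := fun _ x => x) fun i => aemeasurable_id).indepFun hij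
  rw [Tame.integral_mul hi (tame_comp_eval i hF) (tame_comp_eval j hG),
    integral_comp_of_hasLaw (measurePreserving_eval ν i).hasLaw hF,
    integral_comp_of_hasLaw (measurePreserving_eval ν j).hasLaw hG]

/-- Independent copies of a white family, taken together, form a white family. -/
lemma White.pi [DecidableEq ι] [DecidableEq J] {g : ι → 𝓤 → ℂ} {γ : ι → ℂ} (hg : White mU μ g γ) :
    White inferInstance (Measure.pi fun _ : J => μ) (fun (a : J × ι) x => g a.2 (x a.1))
      (fun a => γ a.2) := by
  refine ⟨fun a => (tame_comp_eval (ν := fun _ => μ) a.1 (hg.tame a.2)).mono (comap_eval_le a.1),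
    fun a => ?_, fun a b => ?_⟩
  · rw [integral_comp_of_hasLaw (measurePreserving_eval (fun _ : J => μ) a.1).hasLaw (hg.tame a.2),
      hg.mean]
  · obtain ⟨i, a⟩ := a
    obtain ⟨j, b⟩ := b
    by_cases hij : i = j
    · subst hij
      rw [integral_comp_of_hasLaw (F := fun x => g a x * star (g b x))
        (measurePreserving_eval (fun _ : J => μ) i).hasLaw
        ((hg.tame a).mul (hg.tame b).conj), hg.cov]
      simp
    · rw [integral_comp_eval_mul (ν := fun _ => μ) hij (hg.tame a) (hg.tame b).conj, hg.mean]
      simp [hij]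

lemma white_complexGaussian {M : ℕ} {C : Matrix (Fin M) (Fin M) ℂ} (hC : C.PosSemidef) {v : ℂ}
    (hv : ∀ a b, C a b = if a = b then v else 0) :
    White inferInstance (complexGaussian C) (fun a h => h a) (fun _ => v) :=
  ⟨tame_eval_complexGaussian, integral_eval_complexGaussian,
    fun a b => by rw [integral_two_complexGaussian hC, hv]⟩

lemma comap_prodMk_eq_sup {𝓐 𝓑 : Type*} {mA : MeasurableSpace 𝓐} {mB : MeasurableSpace 𝓑}
    (A : Ω → 𝓐) (B : Ω → 𝓑) :
    (Prod.instMeasurableSpace.comap fun ω => (A ω, B ω)) = mA.comap A ⊔ mB.comap B :=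
  MeasurableSpace.comap_prodMk A B

lemma hasLaw_prod_split {𝓐 𝓑 : Type*} [MeasurableSpace 𝓐] [MeasurableSpace 𝓑] {A : Ω → 𝓐}
    {B : Ω → 𝓑} {μ : Measure 𝓐} {ν : Measure 𝓑} [IsProbabilityMeasure μ] [IsProbabilityMeasure ν]
    [IsFiniteMeasure P] (h : HasLaw (fun ω => (A ω, B ω)) (μ.prod ν) P) :
    HasLaw A μ P ∧ HasLaw B ν P ∧ IndepFun A B P := by
  have hA : HasLaw A μ P := measurePreserving_fst.comp_hasLaw h
  have hB : HasLaw B ν P := measurePreserving_snd.comp_hasLaw h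
  exact ⟨hA, hB, (indepFun_iff_hasLaw_prodMk_prod hA hB).2 h⟩

lemma hasLaw_prod_assoc {𝓐 𝓑 𝓒 : Type*} [MeasurableSpace 𝓐] [MeasurableSpace 𝓑]
    [MeasurableSpace 𝓒] {A : Ω → 𝓐} {B : Ω → 𝓑} {C : Ω → 𝓒} {μ : Measure 𝓐} {ν : Measure 𝓑}
    {κ : Measure 𝓒} [IsProbabilityMeasure μ] [IsProbabilityMeasure ν] [IsProbabilityMeasure κ]
    (h : HasLaw (fun ω => (A ω, B ω, C ω)) (μ.prod (ν.prod κ)) P) :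
    HasLaw (fun ω => ((A ω, B ω), C ω)) ((μ.prod ν).prod κ) P := by
  have hp : MeasurePreserving MeasurableEquiv.prodAssoc ((μ.prod ν).prod κ) (μ.prod (ν.prod κ)) :=
    ⟨MeasurableEquiv.prodAssoc.measurable, Measure.prodAssoc_prod⟩
  exact (hp.symm _).comp_hasLaw h

end Transfer

/-- The moments of the random inputs that enter the spectral efficiency analysis. The `σ`-algebras
`mH`, `mN`, `mE` and `mD` carry the channels, the pilot noise, the pilot distortion, and the inputs
of the data sample. -/
structure SignalMoments {Ω : Type*} {M K τp : ℕ} (mH mN mE mD : MeasurableSpace Ω)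
    {m₀ : MeasurableSpace Ω} (S : Params M K τp) (X : Signals Ω M K τp) (P : Measure Ω) : Prop where
  indep_pilot : Indep mH (mN ⊔ mE) P
  indep_data : Indep (mH ⊔ (mN ⊔ mE)) mD P
  indep_noise : Indep mN mE P
  tame_h : ∀ i a, Tame mH P (fun ω => X.h i ω a)
  two_h : ∀ i a b, ∫ ω, X.h i ω a * star (X.h i ω b) ∂P = S.R i a b
  four_h : ∀ i l a b c d,
    ∫ ω, (X.h i ω a * star (X.h i ω b)) * (X.h l ω c * star (X.h l ω d)) ∂P
      = S.R i a b * S.R l c d + if i = l then S.R i a d * S.R i c b else 0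
  white_N : White mN P (fun (a : Fin τp × Fin M) ω => X.N a.1 ω a.2) (fun _ => (S.σ : ℂ) ^ 2)
  white_rp : White mE P (fun (a : Fin τp × Fin M) ω => X.rp a.1 ω a.2) (fun _ => 1)
  white_data : White mD P
    (Sum.elim (fun i ω => X.s i ω) (Sum.elim (fun a ω => X.n ω a) fun a ω => X.r ω a))
    (Sum.elim (fun _ => 1) (Sum.elim (fun _ => (S.σ : ℂ) ^ 2) fun _ => 1))

/-- The model law provides these moments. The independence of the blocks is read off the product
measure, regrouped once so that everything before the data sample forms a single factor. -/
theorem exists_signalMoments {Ω : Type*} [m₀ : MeasurableSpace Ω] {P : Measure Ω}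
    [IsProbabilityMeasure P] {M K τp : ℕ} {S : Params M K τp} {X : Signals Ω M K τp}
    (hR : ∀ i, (S.R i).PosSemidef) (hX : X.HasModelLaw S P) :
    ∃ mH mN mE mD : MeasurableSpace Ω, SignalMoments mH mN mE mD S X P := by
  have hσ : (realDiag fun _ : Fin M => S.σ ^ 2).PosSemidef := by
    refine Matrix.PosSemidef.diagonal fun m => ?_
    exact Complex.zero_le_real.2 (sq_nonneg S.σ)
  have hσv : ∀ a b, (realDiag fun _ : Fin M => S.σ ^ 2) a b = if a = b then (S.σ : ℂ) ^ 2 else 0 :=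
    fun a b => by simp [realDiag, Matrix.diagonal_apply]
  have h1v : ∀ a b, (1 : Matrix (Fin M) (Fin M) ℂ) a b = if a = b then 1 else 0 :=
    fun a b => Matrix.one_apply
  obtain ⟨lawH, law1, ind1⟩ := hasLaw_prod_split hX
  obtain ⟨lawN, law2, ind2⟩ := hasLaw_prod_split law1
  obtain ⟨lawR, law3, -⟩ := hasLaw_prod_split law2
  obtain ⟨lawS, law4, ind4⟩ := hasLaw_prod_split law3
  obtain ⟨lawn, lawr, ind5⟩ := hasLaw_prod_split law4
  obtain ⟨-, -, ind0⟩ := hasLaw_prod_split (hasLaw_prod_assoc (hasLaw_prod_assoc hX))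
  rw [IndepFun_iff_Indep] at ind0 ind1 ind2 ind4 ind5
  simp only [comap_prodMk_eq_sup] at ind0 ind1 ind2 ind4
  have wN := White.comp_hasLaw lawN (White.pi (J := Fin τp) (white_complexGaussian hσ hσv))
  have wR := White.comp_hasLaw lawR
    (White.pi (J := Fin τp) (white_complexGaussian Matrix.PosSemidef.one h1v))
  have wS := White.comp_hasLaw lawS white_pi_stdComplexGaussian
  have wn := White.comp_hasLaw lawn (white_complexGaussian hσ hσv)
  have wr := White.comp_hasLaw lawr (white_complexGaussian Matrix.PosSemidef.one h1v)
  have tH : ∀ i a, Tame inferInstance (Measure.pi fun i => complexGaussian (S.R i))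
      (fun h : Fin K → Fin M → ℂ => h i a) := fun i a =>
    (tame_comp_eval (ν := fun i => complexGaussian (S.R i)) i
      (tame_eval_complexGaussian a)).mono (comap_eval_le i)
  refine ⟨_, _, _, _, ⟨?_, ?_, ?_, fun i a => tame_comp_of_hasLaw lawH (tH i a), fun i a b => ?_,
    fun i l a b c d => ?_, wN, wR,
    wS.sumElim (wn.sumElim wr ind5 le_sup_left le_sup_right) ind4 le_sup_left le_sup_right⟩⟩
  · exact indep_of_indep_of_le_right ind1 (sup_le_sup_left le_sup_left _)
  · rw [← sup_assoc]
    exact ind0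
  · exact indep_of_indep_of_le_right ind2 le_sup_left
  · have t2 : Tame inferInstance (complexGaussian (S.R i)) (fun h => h a * star (h b)) :=
      (tame_eval_complexGaussian a).mul (tame_eval_complexGaussian b).conj
    have := integral_comp_of_hasLaw
      ((measurePreserving_eval (fun i => complexGaussian (S.R i)) i).fun_comp_hasLaw lawH) t2
    rw [integral_two_complexGaussian (hR i)] at this
    exact this
  · have t2 : ∀ i a b, Tame inferInstance (complexGaussian (S.R i))
        (fun h : Fin M → ℂ => h a * star (h b)) := fun i a b =>
      (tame_eval_complexGaussian a).mul (tame_eval_complexGaussian b).conj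
    by_cases hil : i = l
    · subst hil
      have := integral_comp_of_hasLaw
        ((measurePreserving_eval (fun i => complexGaussian (S.R i)) i).fun_comp_hasLaw lawH)
        ((t2 i a b).mul (t2 i c d))
      rw [integral_four_complexGaussian (hR i)] at this
      rw [if_pos rfl]
      exact this
    · have h1 := integral_comp_of_hasLaw lawH (F := fun h : Fin K → Fin M → ℂ =>
        (h i a * star (h i b)) * (h l c * star (h l d)))
        (((tH i a).mul (tH i b).conj).mul ((tH l c).mul (tH l d).conj))
      have h2 := integral_comp_eval_mul (ν := fun i => complexGaussian (S.R i)) hil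
        (t2 i a b) (t2 l c d)
      rw [integral_two_complexGaussian (hR i), integral_two_complexGaussian (hR l)] at h2
      rw [if_neg hil, add_zero]
      exact h1.trans h2

section Pilot

variable {Ω : Type*} {M K τp : ℕ} {mH mN mE mD m₀ : MeasurableSpace Ω} {S : Params M K τp}
  {X : Signals Ω M K τp} {P : Measure Ω} [IsProbabilityMeasure P]

/-! ### Second- and fourth-order moments of linear images of the channels -/

lemma SignalMoments.tame_mulVec_h (hS : SignalMoments mH mN mE mD S X P) (i : Fin K)
    (B : Matrix (Fin M) (Fin M) ℂ) (m : Fin M) : Tame mH P (fun ω => (B *ᵥ X.h i ω) m) :=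
  tame_mulVec (hS.tame_h i) B m

lemma mulVec_mul_star_eq_sum (B : Matrix (Fin M) (Fin M) ℂ) (x : Fin M → ℂ) (m : Fin M) :
    (B *ᵥ x) m * star ((B *ᵥ x) m) =
      ∑ a, ∑ b, (B m a * star (B m b)) * (x a * star (x b)) := by
  simp only [mulVec_apply_eq_sum, star_sum, star_mul', Finset.sum_mul_sum]
  refine Finset.sum_congr rfl fun a _ => Finset.sum_congr rfl fun b _ => ?_
  ring

lemma mul_mul_conjTranspose_apply (B C : Matrix (Fin M) (Fin M) ℂ) (m : Fin M) :
    (B * C * Bᴴ) m m = ∑ a, ∑ b, (B m a * star (B m b)) * C a b := by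
  simp only [Matrix.mul_apply, Matrix.conjTranspose_apply, Finset.sum_mul]
  rw [Finset.sum_comm]
  refine Finset.sum_congr rfl fun a _ => Finset.sum_congr rfl fun b _ => ?_
  ring

lemma SignalMoments.integral_normSq_mulVec_h (hS : SignalMoments mH mN mE mD S X P) (i : Fin K)
    (B : Matrix (Fin M) (Fin M) ℂ) (m : Fin M) :
    ∫ ω, (B *ᵥ X.h i ω) m * star ((B *ᵥ X.h i ω) m) ∂P = (B * S.R i * Bᴴ) m m := by
  simp only [mulVec_mul_star_eq_sum]
  rw [Tame.integral_sum_sum fun a b => ((hS.tame_h i a).mul (hS.tame_h i b).conj).const_mul _]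
  simp only [integral_const_mul, hS.two_h, mul_mul_conjTranspose_apply]

lemma SignalMoments.integral_normSq_h_mul_normSq_mulVec_h (hR : ∀ i, (S.R i).PosSemidef)
    (hS : SignalMoments mH mN mE mD S X P) (i j : Fin K)
    (B : Matrix (Fin M) (Fin M) ℂ) (l m : Fin M) :
    ∫ ω, (X.h j ω l * star (X.h j ω l)) * ((B *ᵥ X.h i ω) m * star ((B *ᵥ X.h i ω) m)) ∂P
      = S.R j l l * (B * S.R i * Bᴴ) m m
        + if j = i then (B * S.R i) m l * star ((B * S.R i) m l) else 0 := by
  have e : ∀ ω, (X.h j ω l * star (X.h j ω l)) * ((B *ᵥ X.h i ω) m * star ((B *ᵥ X.h i ω) m))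
      = ∑ a, ∑ b, (B m a * star (B m b)) *
        ((X.h j ω l * star (X.h j ω l)) * (X.h i ω a * star (X.h i ω b))) := fun ω => by
    rw [mulVec_mul_star_eq_sum, Finset.mul_sum]
    refine Finset.sum_congr rfl fun a _ => ?_
    rw [Finset.mul_sum]
    refine Finset.sum_congr rfl fun b _ => ?_
    ring
  simp only [e]
  rw [Tame.integral_sum_sum fun a b => (((hS.tame_h j l).mul (hS.tame_h j l).conj).mul
    ((hS.tame_h i a).mul (hS.tame_h i b).conj)).const_mul _]
  simp only [integral_const_mul, hS.four_h, mul_add, Finset.sum_add_distrib]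
  rw [mul_mul_conjTranspose_apply, Finset.mul_sum]
  congr 1
  · refine Finset.sum_congr rfl fun a _ => ?_
    rw [Finset.mul_sum]
    refine Finset.sum_congr rfl fun b _ => ?_
    ring
  · split_ifs with h
    · subst h
      simp only [Matrix.mul_apply, star_sum, star_mul', Finset.sum_mul_sum]
      refine Finset.sum_congr rfl fun a _ => Finset.sum_congr rfl fun b _ => ?_
      rw [(hR j).1.apply]
      ring
    · simp

/-- Second moment of a Hermitian form in two channels. Equal indices produce the additional coherent
term `|tr(A Rₖ)|²`. -/
lemma SignalMoments.integral_normSq_form_h (hS : SignalMoments mH mN mE mD S X P) (i k : Fin K)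
    (hR : ∀ i, (S.R i).PosSemidef) (A : Matrix (Fin M) (Fin M) ℂ) :
    ∫ ω, (star (X.h i ω) ⬝ᵥ A *ᵥ X.h k ω) * star (star (X.h i ω) ⬝ᵥ A *ᵥ X.h k ω) ∂P
      = (A * S.R k * Aᴴ * S.R i).trace
        + if k = i then (A * S.R k).trace * star (A * S.R k).trace else 0 := by
  have e : ∀ ω, (star (X.h i ω) ⬝ᵥ A *ᵥ X.h k ω) * star (star (X.h i ω) ⬝ᵥ A *ᵥ X.h k ω)
      = ∑ m, ∑ l, ∑ n, ∑ o, (A m l * star (A n o)) *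
        ((X.h k ω l * star (X.h k ω o)) * (X.h i ω n * star (X.h i ω m))) := fun ω => by
    have e1 : star (X.h i ω) ⬝ᵥ A *ᵥ X.h k ω =
        ∑ m, ∑ l, A m l * (star (X.h i ω m) * X.h k ω l) := by
      simp only [dotProduct, mulVec_apply_eq_sum, Finset.mul_sum, Pi.star_apply]
      refine Finset.sum_congr rfl fun a _ => Finset.sum_congr rfl fun b _ => ?_
      ring
    rw [e1]
    simp only [star_sum, Finset.sum_mul]
    simp only [Finset.mul_sum]
    refine Finset.sum_congr rfl fun m _ => Finset.sum_congr rfl fun l _ =>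
      Finset.sum_congr rfl fun n _ => Finset.sum_congr rfl fun o _ => ?_
    simp only [star_mul', star_star]
    ring
  have t : ∀ m l n o, Tame mH P (fun ω => (A m l * star (A n o)) *
        ((X.h k ω l * star (X.h k ω o)) * (X.h i ω n * star (X.h i ω m)))) := fun m l n o =>
    (((hS.tame_h k l).mul (hS.tame_h k o).conj).mul
      ((hS.tame_h i n).mul (hS.tame_h i m).conj)).const_mul _
  have t' : ∀ m l, ∫ ω, ∑ n, ∑ o, (A m l * star (A n o)) *
        ((X.h k ω l * star (X.h k ω o)) * (X.h i ω n * star (X.h i ω m))) ∂P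
      = ∑ n, ∑ o, (A m l * star (A n o)) * (S.R k l o * S.R i n m +
          if k = i then S.R k l m * S.R k n o else 0) := fun m l => by
    rw [Tame.integral_sum_sum (t m l)]
    simp only [integral_const_mul, hS.four_h]
  simp only [e]
  rw [Tame.integral_sum_sum fun m l => Tame.sum fun n => Tame.sum fun o => t m l n o]
  simp only [t', mul_add, Finset.sum_add_distrib]
  congr 1
  · simp only [Matrix.trace, Matrix.diag_apply, Matrix.mul_apply, Matrix.conjTranspose_apply,
      Finset.sum_mul]
    refine Finset.sum_congr rfl fun m _ => ?_
    rw [Finset.sum_comm]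
    refine Finset.sum_congr rfl fun n _ => ?_
    rw [Finset.sum_comm]
    refine Finset.sum_congr rfl fun l _ => Finset.sum_congr rfl fun o _ => ?_
    ring
  · split_ifs with h
    · simp only [Matrix.trace, Matrix.diag_apply, Matrix.mul_apply, star_sum, star_mul',
        Finset.sum_mul]
      simp only [Finset.mul_sum]
      refine Finset.sum_congr rfl fun m _ => Finset.sum_congr rfl fun l _ =>
        Finset.sum_congr rfl fun n _ => Finset.sum_congr rfl fun o _ => ?_
      rw [← (hR k).1.apply n o]
      ring
    · simp

lemma SignalMoments.integral_form_h (hS : SignalMoments mH mN mE mD S X P) (k : Fin K)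
    (A : Matrix (Fin M) (Fin M) ℂ) :
    ∫ ω, star (X.h k ω) ⬝ᵥ A *ᵥ X.h k ω ∂P = (A * S.R k).trace := by
  have e1 : ∀ ω, star (X.h k ω) ⬝ᵥ A *ᵥ X.h k ω =
      ∑ m, ∑ l, A m l * (X.h k ω l * star (X.h k ω m)) := fun ω => by
    simp only [dotProduct, mulVec_apply_eq_sum, Finset.mul_sum, Pi.star_apply]
    refine Finset.sum_congr rfl fun a _ => Finset.sum_congr rfl fun b _ => ?_
    ring
  simp only [e1]
  rw [Tame.integral_sum_sum fun m l =>
    ((hS.tame_h k l).mul (hS.tame_h k m).conj).const_mul (A m l)]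
  simp only [integral_const_mul, hS.two_h, Matrix.trace, Matrix.diag_apply, Matrix.mul_apply]

/-! ### The channel observation -/

/-- The energy `∑ᵢ aᵢ |[hᵢ]ₘ|²` received at antenna `m` when user `i` transmits with energy `aᵢ`. -/
noncomputable def antennaEnergy (X : Signals Ω M K τp) (a : Fin K → ℝ) (m : Fin M) (ω : Ω) : ℝ :=
  ∑ i, a i * ‖X.h i ω m‖ ^ 2

lemma antennaEnergy_nonneg {a : Fin K → ℝ} (ha : ∀ i, 0 ≤ a i) (m : Fin M) (ω : Ω) :
    0 ≤ antennaEnergy X a m ω :=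
  Finset.sum_nonneg fun i _ => mul_nonneg (ha i) (sq_nonneg _)

lemma ofReal_antennaEnergy (a : Fin K → ℝ) (m : Fin M) (ω : Ω) :
    (antennaEnergy X a m ω : ℂ) = ∑ i, (a i : ℂ) * (X.h i ω m * star (X.h i ω m)) := by
  simp [antennaEnergy, Complex.mul_conj, Complex.normSq_eq_norm_sq]

lemma SignalMoments.tame_antennaEnergy (hS : SignalMoments mH mN mE mD S X P) (a : Fin K → ℝ)
    (m : Fin M) : Tame mH P (fun ω => (antennaEnergy X a m ω : ℂ)) := by
  simp only [ofReal_antennaEnergy]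
  exact Tame.sum fun i => ((hS.tame_h i m).mul (hS.tame_h i m).conj).const_mul _

/-- De-spreading of a pilot disturbance: `∑ⱼ [φₖ]ⱼ^* Nⱼ / (τp √qₖ)`. -/
noncomputable def despread (S : Params M K τp) (k : Fin K) (N : Fin τp → Ω → Fin M → ℂ)
    (m : Fin M) (ω : Ω) : ℂ :=
  ∑ j, (((τp * Real.sqrt (S.q k) : ℝ) : ℂ)⁻¹ * star (S.φ k j)) * N j ω m

/-- The error `zₖ - hₖ` of the channel observation: de-spread noise, plus de-spread distortion whose
amplitude is set by the energy received at each antenna. -/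
noncomputable def obsError (S : Params M K τp) (X : Signals Ω M K τp) (k : Fin K) (m : Fin M)
    (ω : Ω) : ℂ :=
  despread S k X.N m ω
    + ((S.ε m : ℂ) * (Real.sqrt (antennaEnergy X S.q m ω) : ℂ)) * despread S k X.rp m ω

lemma observation_apply (hτp : 0 < τp) (hq : ∀ i, 0 ≤ S.q i) (hφ : S.OrthogonalPilots) (k : Fin K)
    (hqk : 0 < S.q k) (ω : Ω) (m : Fin M) :
    observation S X P k ω m = X.h k ω m + obsError S X k m ω := by
  have hE : ∀ j, receivedEnergy P X.h (pilotInput S j) ω m = antennaEnergy X S.q m ω := fun j => by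
    refine Finset.sum_congr rfl fun i _ => ?_
    simp [pilotInput, hφ.1, Real.sq_sqrt (hq i), abs_of_nonneg, Real.sqrt_nonneg]
  have hD : ∀ j, distortion P S.ε X.h (pilotInput S j) (X.rp j) ω m
      = (S.ε m : ℂ) * (Real.sqrt (antennaEnergy X S.q m ω) : ℂ) * X.rp j ω m := fun j => by
    simp [distortion, realDiag, Matrix.diagonal_mul_diagonal, Matrix.mulVec_diagonal, hE]
  have hz : observation S X P k ω m = ((τp * Real.sqrt (S.q k) : ℝ) : ℂ)⁻¹ *
      ∑ j, star (S.φ k j) * ((∑ i, (Real.sqrt (S.q i) : ℂ) * S.φ i j * X.h i ω m) + X.N j ω m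
        + (S.ε m : ℂ) * (Real.sqrt (antennaEnergy X S.q m ω) : ℂ) * X.rp j ω m) := by
    simp only [observation, Pi.smul_apply, Finset.sum_apply, smul_eq_mul, pilotReceived, received,
      Pi.add_apply, hD, pilotInput]
  have hsig : ∑ j, star (S.φ k j) * ∑ i, (Real.sqrt (S.q i) : ℂ) * S.φ i j * X.h i ω m
      = ((τp * Real.sqrt (S.q k) : ℝ) : ℂ) * X.h k ω m := by
    calc _ = ∑ i, (Real.sqrt (S.q i) : ℂ) * X.h i ω m * (star (S.φ k) ⬝ᵥ S.φ i) := by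
          simp only [dotProduct, Finset.mul_sum, Pi.star_apply]
          rw [Finset.sum_comm]
          refine Finset.sum_congr rfl fun i _ => Finset.sum_congr rfl fun j _ => ?_
          ring
      _ = _ := by
          simp only [hφ.2]
          simp
          ring
  have hne : ((τp * Real.sqrt (S.q k) : ℝ) : ℂ) ≠ 0 := by
    rw [Complex.ofReal_ne_zero]
    have := Real.sqrt_pos.2 hqk
    positivity
  rw [hz]
  simp only [mul_add, Finset.sum_add_distrib]
  rw [hsig, inv_mul_cancel_left₀ hne, obsError, despread, despread, Finset.mul_sum, Finset.mul_sum,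
    Finset.mul_sum, add_assoc]
  congr 2
  · exact Finset.sum_congr rfl fun j _ => by ring
  · exact Finset.sum_congr rfl fun j _ => by ring

lemma sum_despread_coeff (hτp : 0 < τp) (hφ : S.OrthogonalPilots) (k : Fin K)
    (hqk : 0 < S.q k) :
    ∑ j, (((τp * Real.sqrt (S.q k) : ℝ) : ℂ)⁻¹ * star (S.φ k j)) *
      star (((τp * Real.sqrt (S.q k) : ℝ) : ℂ)⁻¹ * star (S.φ k j)) = 1 / ((τp : ℂ) * S.q k) := by
  have h1 : ∀ j, star (S.φ k j) * S.φ k j = 1 := fun j => by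
    have := hφ.1 k j
    rw [mul_comm, Complex.star_def, Complex.mul_conj, Complex.normSq_eq_norm_sq, this]
    simp
  have hs : (Real.sqrt (S.q k) : ℂ) * (Real.sqrt (S.q k) : ℂ) = S.q k := by
    rw [← Complex.ofReal_mul, Real.mul_self_sqrt hqk.le]
  have hτ : (τp : ℂ) ≠ 0 := by exact_mod_cast hτp.ne'
  have hq' : (S.q k : ℂ) ≠ 0 := by exact_mod_cast hqk.ne'
  have h2 : ∀ j, (((τp * Real.sqrt (S.q k) : ℝ) : ℂ)⁻¹ * star (S.φ k j)) *
      star (((τp * Real.sqrt (S.q k) : ℝ) : ℂ)⁻¹ * star (S.φ k j))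
      = ((τp : ℂ) * τp * S.q k)⁻¹ := fun j => by
    rw [star_mul', star_star]
    have h3 : star ((τp * Real.sqrt (S.q k) : ℝ) : ℂ)⁻¹ = ((τp * Real.sqrt (S.q k) : ℝ) : ℂ)⁻¹ := by
      rw [← Complex.ofReal_inv, Complex.star_def, Complex.conj_ofReal]
    rw [h3]
    calc _ = ((τp * Real.sqrt (S.q k) : ℝ) : ℂ)⁻¹ * ((τp * Real.sqrt (S.q k) : ℝ) : ℂ)⁻¹ *
          (star (S.φ k j) * S.φ k j) := by ring
      _ = _ := by
        rw [h1, mul_one, ← mul_inv, Complex.ofReal_mul, Complex.ofReal_natCast, ← hs]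
        congr 1
        ring
  simp only [h2, Finset.sum_const, Finset.card_univ, Fintype.card_fin, nsmul_eq_mul]
  field_simp

lemma SignalMoments.white_despread (hS : SignalMoments mH mN mE mD S X P) (hτp : 0 < τp)
    (hφ : S.OrthogonalPilots) (k : Fin K) (hqk : 0 < S.q k) :
    White (mN ⊔ mE) P (Sum.elim (despread S k X.N) (despread S k X.rp))
      (Sum.elim (fun _ => (S.σ : ℂ) ^ 2 * (1 / ((τp : ℂ) * S.q k)))
        fun _ => 1 * (1 / ((τp : ℂ) * S.q k))) := by
  have h1 := hS.white_N.combine (fun j => ((τp * Real.sqrt (S.q k) : ℝ) : ℂ)⁻¹ * star (S.φ k j))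
  have h2 := hS.white_rp.combine (fun j => ((τp * Real.sqrt (S.q k) : ℝ) : ℂ)⁻¹ * star (S.φ k j))
  rw [sum_despread_coeff hτp hφ k hqk] at h1 h2
  exact h1.sumElim h2 hS.indep_noise le_sup_left le_sup_right

lemma SignalMoments.tame_obsError (hS : SignalMoments mH mN mE mD S X P) (hτp : 0 < τp)
    (hφ : S.OrthogonalPilots) (k : Fin K) (hqk : 0 < S.q k) (m : Fin M) :
    Tame (mH ⊔ (mN ⊔ mE)) P (obsError S X k m) :=
  have h := hS.white_despread hτp hφ k hqk
  ((h.tame (Sum.inl m)).mono le_sup_right).add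
    ((((hS.tame_antennaEnergy S.q m).sqrt.const_mul (S.ε m)).mono le_sup_left).mul
      ((h.tame (Sum.inr m)).mono le_sup_right))

lemma affine_obsError_eq (x₀ : ℂ) (x : Fin M → ℂ) (k : Fin K) (ω : Ω) :
    x₀ + ∑ l, x l * obsError S X k l ω = x₀ + ∑ a : Fin M ⊕ Fin M,
      (Sum.elim x (fun l => x l * ((S.ε l : ℂ) * (Real.sqrt (antennaEnergy X S.q l ω) : ℂ))) a) *
        Sum.elim (despread S k X.N) (despread S k X.rp) a ω := by
  rw [Fintype.sum_sum_type, ← Finset.sum_add_distrib]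
  congr 1
  refine Finset.sum_congr rfl fun l _ => ?_
  simp only [obsError, Sum.elim_inl, Sum.elim_inr]
  ring

/-- Covariance of random variables that are affine in the observation error. Given the channels, the
entries of the error are uncorrelated, with variance `(σ² + εₗ² ∑ⱼ qⱼ |[hⱼ]ₗ|²) / (τp qₖ)`. -/
theorem SignalMoments.integral_affine_obsError_mul_star (hS : SignalMoments mH mN mE mD S X P)
    (hτp : 0 < τp) (hq : ∀ i, 0 ≤ S.q i) (hφ : S.OrthogonalPilots) (k : Fin K) (hqk : 0 < S.q k)
    {x₀ y₀ : Ω → ℂ} {x y : Fin M → Ω → ℂ} (hx₀ : Tame mH P x₀) (hx : ∀ l, Tame mH P (x l))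
    (hy₀ : Tame mH P y₀) (hy : ∀ l, Tame mH P (y l)) :
    ∫ ω, (x₀ ω + ∑ l, x l ω * obsError S X k l ω) *
        star (y₀ ω + ∑ l, y l ω * obsError S X k l ω) ∂P
      = ∫ ω, x₀ ω * star (y₀ ω) ∂P + ∑ l, (1 / ((τp : ℂ) * S.q k)) *
        ((S.σ : ℂ) ^ 2 * ∫ ω, x l ω * star (y l ω) ∂P + (S.ε l : ℂ) ^ 2 *
          ∑ j, (S.q j : ℂ) * ∫ ω, (X.h j ω l * star (X.h j ω l)) * (x l ω * star (y l ω)) ∂P) := by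
  have hsq : ∀ l, Tame mH P (fun ω => (S.ε l : ℂ) * (Real.sqrt (antennaEnergy X S.q l ω) : ℂ)) :=
    fun l => (hS.tame_antennaEnergy S.q l).sqrt.const_mul _
  -- the de-spread distortion enters with the random amplitude `εₗ √(∑ⱼ qⱼ |[hⱼ]ₗ|²)`, a function of
  -- the channels only
  have key := (hS.white_despread hτp hφ k hqk).integral_mul_star hS.indep_pilot hx₀
    (x := fun a ω => Sum.elim (fun l => x l ω)
      (fun l => x l ω * ((S.ε l : ℂ) * (Real.sqrt (antennaEnergy X S.q l ω) : ℂ))) a)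
    (y := fun a ω => Sum.elim (fun l => y l ω)
      (fun l => y l ω * ((S.ε l : ℂ) * (Real.sqrt (antennaEnergy X S.q l ω) : ℂ))) a)
    (by rintro (l | l); exacts [hx l, (hx l).mul (hsq l)]) hy₀
    (by rintro (l | l); exacts [hy l, (hy l).mul (hsq l)])
  have e : ∀ l ω, (x l ω * ((S.ε l : ℂ) * (Real.sqrt (antennaEnergy X S.q l ω) : ℂ))) *
      star (y l ω * ((S.ε l : ℂ) * (Real.sqrt (antennaEnergy X S.q l ω) : ℂ)))
      = (S.ε l : ℂ) ^ 2 * ∑ j, (S.q j : ℂ) *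
          ((X.h j ω l * star (X.h j ω l)) * (x l ω * star (y l ω))) := fun l ω => by
    have h1 : (Real.sqrt (antennaEnergy X S.q l ω) : ℂ) * (Real.sqrt (antennaEnergy X S.q l ω) : ℂ)
        = ∑ i, (S.q i : ℂ) * (X.h i ω l * star (X.h i ω l)) := by
      rw [← Complex.ofReal_mul, Real.mul_self_sqrt (antennaEnergy_nonneg hq l ω),
        ofReal_antennaEnergy]
    have h2 : star (y l ω * ((S.ε l : ℂ) * (Real.sqrt (antennaEnergy X S.q l ω) : ℂ)))
        = star (y l ω) * ((S.ε l : ℂ) * (Real.sqrt (antennaEnergy X S.q l ω) : ℂ)) := by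
      simp
    rw [h2]
    calc _ = (S.ε l : ℂ) ^ 2 * ((Real.sqrt (antennaEnergy X S.q l ω) : ℂ) *
          (Real.sqrt (antennaEnergy X S.q l ω) : ℂ) * (x l ω * star (y l ω))) := by ring
      _ = _ := by
        rw [h1, Finset.sum_mul]
        congr 1
        exact Finset.sum_congr rfl fun j _ => by ring
  simp only [affine_obsError_eq]
  rw [key, Fintype.sum_sum_type, ← Finset.sum_add_distrib]
  congr 1
  refine Finset.sum_congr rfl fun l _ => ?_
  simp only [Sum.elim_inl, Sum.elim_inr, e, integral_const_mul]
  rw [Tame.integral_sum fun j => (((hS.tame_h j l).mul (hS.tame_h j l).conj).mul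
    ((hx l).mul (hy l).conj)).const_mul _]
  simp only [integral_const_mul]
  ring

end Pilot

/-! ### The matrix `Ψₖ` -/

section PsiMatrix

variable {M K τp : ℕ} {S : Params M K τp}

/-- The mean energy `(σ² + εₗ² ∑ⱼ qⱼ [Rⱼ]ₗₗ) / (τp qₖ)` of the observation error at antenna `l`. -/
noncomputable def errorVar (S : Params M K τp) (k : Fin K) (l : Fin M) : ℂ :=
  (1 / ((τp : ℂ) * S.q k)) * ((S.σ : ℂ) ^ 2 + (S.ε l : ℂ) ^ 2 * ∑ j, (S.q j : ℂ) * S.R j l l)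

lemma psi_eq (k : Fin K) : Psi S k = S.R k + Matrix.diagonal (errorVar S k) := by
  ext a b
  have h : ∀ i, (realDiag S.ε * diagPart (S.R i) * realDiag S.ε) a b =
      if a = b then (S.ε a : ℂ) ^ 2 * S.R i a a else 0 := fun i => by
    simp only [realDiag, diagPart, Matrix.diagonal_mul_diagonal, Matrix.diagonal_apply,
      Matrix.diag_apply]
    split_ifs
    · ring
    · rfl
  simp only [Psi, Matrix.add_apply, Matrix.smul_apply, Matrix.sum_apply, smul_eq_mul, h,
    Matrix.one_apply, Matrix.diagonal_apply, errorVar]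
  congr 1
  split_ifs
  · rw [Finset.mul_sum]
    congr 2
    · ring
    · exact Finset.sum_congr rfl fun i _ => by ring
  · simp

lemma errorVar_pos (hτp : 0 < τp) (hR : ∀ i, (S.R i).PosSemidef) (hσ : 0 < S.σ)
    (hq : ∀ i, 0 ≤ S.q i) (k : Fin K) (hqk : 0 < S.q k) (l : Fin M) : 0 < errorVar S k l := by
  have h1 : (0 : ℂ) < 1 / ((τp : ℂ) * S.q k) := by
    rw [show (1 / ((τp : ℂ) * S.q k)) = ((1 / (τp * S.q k) : ℝ) : ℂ) by push_cast; rfl]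
    exact Complex.zero_lt_real.2 (by positivity)
  have h2 : (0 : ℂ) < (S.σ : ℂ) ^ 2 := by
    rw [← Complex.ofReal_pow]
    exact Complex.zero_lt_real.2 (by positivity)
  have h3 : (0 : ℂ) ≤ (S.ε l : ℂ) ^ 2 := by
    rw [← Complex.ofReal_pow]
    exact Complex.zero_le_real.2 (by positivity)
  refine mul_pos h1 (add_pos_of_pos_of_nonneg h2 (mul_nonneg h3 (Finset.sum_nonneg fun j _ =>
    mul_nonneg (Complex.zero_le_real.2 (hq j)) ((hR j).diag_nonneg))))

lemma posDef_psi (hτp : 0 < τp) (hR : ∀ i, (S.R i).PosSemidef) (hσ : 0 < S.σ)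
    (hq : ∀ i, 0 ≤ S.q i) (k : Fin K) (hqk : 0 < S.q k) : (Psi S k).PosDef := by
  rw [psi_eq]
  exact Matrix.PosDef.posSemidef_add (hR k)
    (Matrix.PosDef.diagonal fun l => errorVar_pos hτp hR hσ hq k hqk l)

end PsiMatrix

section Combiner

variable {Ω : Type*} {M K τp : ℕ} {mH mN mE mD m₀ : MeasurableSpace Ω} {S : Params M K τp}
  {X : Signals Ω M K τp} {P : Measure Ω} [IsProbabilityMeasure P]

/-! ### The LMMSE estimate and its moments -/

lemma SignalMoments.tame_observation (hS : SignalMoments mH mN mE mD S X P) (hτp : 0 < τp)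
    (hq : ∀ i, 0 ≤ S.q i) (hφ : S.OrthogonalPilots) (k : Fin K) (hqk : 0 < S.q k) (m : Fin M) :
    Tame (mH ⊔ (mN ⊔ mE)) P (fun ω => observation S X P k ω m) := by
  simp only [observation_apply hτp hq hφ k hqk]
  exact ((hS.tame_h k m).mono le_sup_left).add (hS.tame_obsError hτp hφ k hqk m)

lemma observation_eq_affine (hτp : 0 < τp) (hq : ∀ i, 0 ≤ S.q i) (hφ : S.OrthogonalPilots)
    (k : Fin K) (hqk : 0 < S.q k) (ω : Ω) (m : Fin M) :
    observation S X P k ω m =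
      X.h k ω m + ∑ l, (if m = l then 1 else 0) * obsError S X k l ω := by
  simp [observation_apply hτp hq hφ k hqk]

/-- The observation error is uncorrelated with the channel, although its conditional variance depends
on the channels. -/
theorem SignalMoments.corr_h_observation (hS : SignalMoments mH mN mE mD S X P) (hτp : 0 < τp)
    (hq : ∀ i, 0 ≤ S.q i) (hφ : S.OrthogonalPilots) (k : Fin K) (hqk : 0 < S.q k) :
    corr P (X.h k) (observation S X P k) = S.R k := by
  ext a b
  have := hS.integral_affine_obsError_mul_star hτp hq hφ k hqk (hS.tame_h k a)
    (x := fun _ _ => 0) (fun _ => tame_const 0) (hS.tame_h k b)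
    (y := fun l _ => if b = l then 1 else 0) (fun _ => tame_const _)
  simp only [← observation_eq_affine (P := P) hτp hq hφ k hqk, hS.two_h, zero_mul,
    Finset.sum_const_zero, add_zero, integral_zero, mul_zero] at this
  exact this

theorem SignalMoments.corr_observation (hS : SignalMoments mH mN mE mD S X P) (hτp : 0 < τp)
    (hq : ∀ i, 0 ≤ S.q i) (hφ : S.OrthogonalPilots) (k : Fin K) (hqk : 0 < S.q k) :
    corr P (observation S X P k) (observation S X P k) = Psi S k := by
  ext a b
  have := hS.integral_affine_obsError_mul_star hτp hq hφ k hqk (hS.tame_h k a)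
    (x := fun l _ => if a = l then 1 else 0) (fun _ => tame_const _) (hS.tame_h k b)
    (y := fun l _ => if b = l then 1 else 0) (fun _ => tame_const _)
  simp only [← observation_eq_affine (P := P) hτp hq hφ k hqk, hS.two_h] at this
  refine this.trans ?_
  rw [psi_eq, Matrix.add_apply, Matrix.diagonal_apply, errorVar]
  congr 1
  rw [Finset.sum_eq_single a (fun l _ hl => by simp [Ne.symm hl]) (by simp)]
  by_cases hab : a = b
  · subst hab
    simp only [if_true, star_one, mul_one, hS.two_h]
    simp
  · simp [hab, Ne.symm hab]

/-- The matrix `Rₖ Ψₖ⁻¹` that maps the observation to the channel estimate. -/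
noncomputable def estimator (S : Params M K τp) (k : Fin K) : Matrix (Fin M) (Fin M) ℂ :=
  S.R k * (Psi S k)⁻¹

lemma SignalMoments.mrCombiner_eq (hS : SignalMoments mH mN mE mD S X P) (hτp : 0 < τp)
    (hq : ∀ i, 0 ≤ S.q i) (hφ : S.OrthogonalPilots) (k : Fin K) (hqk : 0 < S.q k) :
    mrCombiner S X P k = fun ω => estimator S k *ᵥ observation S X P k ω := by
  ext ω m
  rw [mrCombiner, lmmse, hS.corr_h_observation hτp hq hφ k hqk,
    hS.corr_observation hτp hq hφ k hqk, estimator]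

lemma SignalMoments.tame_linearCombiner (hS : SignalMoments mH mN mE mD S X P) (hτp : 0 < τp)
    (hq : ∀ i, 0 ≤ S.q i) (hφ : S.OrthogonalPilots) (k : Fin K) (hqk : 0 < S.q k)
    (A : Matrix (Fin M) (Fin M) ℂ) (m : Fin M) :
    Tame (mH ⊔ (mN ⊔ mE)) P (fun ω => (A *ᵥ observation S X P k ω) m) :=
  tame_mulVec (hS.tame_observation hτp hq hφ k hqk) A m

lemma linearCombiner_apply (hτp : 0 < τp) (hq : ∀ i, 0 ≤ S.q i) (hφ : S.OrthogonalPilots)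
    (k : Fin K) (hqk : 0 < S.q k) (A : Matrix (Fin M) (Fin M) ℂ) (ω : Ω) (m : Fin M) :
    (A *ᵥ observation S X P k ω) m =
      (A *ᵥ X.h k ω) m + ∑ l, A m l * obsError S X k l ω := by
  simp only [mulVec_apply_eq_sum, observation_apply hτp hq hφ k hqk, mul_add,
    Finset.sum_add_distrib]

lemma star_combine_linearCombiner (hτp : 0 < τp) (hq : ∀ i, 0 ≤ S.q i) (hφ : S.OrthogonalPilots)
    (k : Fin K) (hqk : 0 < S.q k) (A : Matrix (Fin M) (Fin M) ℂ) (i : Fin K) (ω : Ω) :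
    star (combine (fun ω => A *ᵥ observation S X P k ω) (X.h i) ω) =
      star (X.h i ω) ⬝ᵥ A *ᵥ X.h k ω
        + ∑ l, star ((Aᴴ *ᵥ X.h i ω) l) * obsError S X k l ω := by
  rw [combine, ← Matrix.star_dotProduct]
  have h1 : A *ᵥ observation S X P k ω = A *ᵥ X.h k ω + A *ᵥ (fun l => obsError S X k l ω) := by
    ext m
    rw [linearCombiner_apply hτp hq hφ k hqk]
    rfl
  rw [h1, dotProduct_add, Matrix.dotProduct_mulVec (star (X.h i ω)) A (fun l => obsError S X k l ω),
    ← Matrix.conjTranspose_conjTranspose A, ← Matrix.star_mulVec,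
    Matrix.conjTranspose_conjTranspose]
  rfl

lemma SignalMoments.tame_form_h (hS : SignalMoments mH mN mE mD S X P) (i k : Fin K)
    (A : Matrix (Fin M) (Fin M) ℂ) : Tame mH P (fun ω => star (X.h i ω) ⬝ᵥ A *ᵥ X.h k ω) :=
  Tame.sum fun m => (hS.tame_h i m).conj.mul (hS.tame_mulVec_h k A m)

/-- The mean of the effective channel `vᴴ hₖ`. -/
theorem SignalMoments.integral_combine_h (hS : SignalMoments mH mN mE mD S X P) (hτp : 0 < τp)
    (hq : ∀ i, 0 ≤ S.q i) (hφ : S.OrthogonalPilots) (k : Fin K) (hqk : 0 < S.q k)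
    (A : Matrix (Fin M) (Fin M) ℂ) :
    ∫ ω, combine (fun ω => A *ᵥ observation S X P k ω) (X.h k) ω ∂P
      = star (A * S.R k).trace := by
  have h := hS.integral_affine_obsError_mul_star hτp hq hφ k hqk (hS.tame_form_h k k A)
    (fun l => (hS.tame_mulVec_h k Aᴴ l).conj) (y₀ := fun _ => 1) (tame_const 1)
    (y := fun _ _ => 0) (fun _ => tame_const 0)
  simp only [← star_combine_linearCombiner (P := P) hτp hq hφ k hqk, zero_mul,
    Finset.sum_const_zero, add_zero, star_one, mul_one, star_zero, mul_zero, integral_zero,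
    hS.integral_form_h] at h
  rw [integral_star] at h
  rw [← h, star_star]

/-- Second moment of the effective channel `vᴴ hᵢ`. The first trace collects all products of second
moments, the middle term is the coherent gain of the desired user, and the last sum is the excess
caused by pilot distortion being proportional to `|[hᵢ]ₗ|²`. -/
theorem SignalMoments.integral_normSq_combine_h (hS : SignalMoments mH mN mE mD S X P)
    (hR : ∀ i, (S.R i).PosSemidef) (hτp : 0 < τp)
    (hq : ∀ i, 0 ≤ S.q i) (hφ : S.OrthogonalPilots) (k : Fin K) (hqk : 0 < S.q k)
    (A : Matrix (Fin M) (Fin M) ℂ) (i : Fin K) :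
    ((∫ ω, ‖combine (fun ω => A *ᵥ observation S X P k ω) (X.h i) ω‖ ^ 2 ∂P : ℝ) : ℂ)
      = (A * Psi S k * Aᴴ * S.R i).trace
        + (if k = i then (A * S.R k).trace * star (A * S.R k).trace else 0)
        + (S.q i : ℂ) / ((τp : ℂ) * S.q k) *
          ∑ l, (S.ε l : ℂ) ^ 2 * ((Aᴴ * S.R i) l l * star ((Aᴴ * S.R i) l l)) := by
  have h := hS.integral_affine_obsError_mul_star hτp hq hφ k hqk (hS.tame_form_h i k A)
    (fun l => (hS.tame_mulVec_h i Aᴴ l).conj) (hS.tame_form_h i k A)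
    (fun l => (hS.tame_mulVec_h i Aᴴ l).conj)
  simp only [← star_combine_linearCombiner (P := P) hτp hq hφ k hqk,
    hS.integral_normSq_form_h i k hR, star_star] at h
  have e1 : ∀ l ω, star ((Aᴴ *ᵥ X.h i ω) l) * (Aᴴ *ᵥ X.h i ω) l
      = (Aᴴ *ᵥ X.h i ω) l * star ((Aᴴ *ᵥ X.h i ω) l) := fun l ω => mul_comm _ _
  have e2 : ∀ ω, star (combine (fun ω => A *ᵥ observation S X P k ω) (X.h i) ω) *
      combine (fun ω => A *ᵥ observation S X P k ω) (X.h i) ω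
      = combine (fun ω => A *ᵥ observation S X P k ω) (X.h i) ω *
        star (combine (fun ω => A *ᵥ observation S X P k ω) (X.h i) ω) := fun ω => mul_comm _ _
  simp only [e1, e2, hS.integral_normSq_mulVec_h, hS.integral_normSq_h_mul_normSq_mulVec_h hR] at h
  rw [integral_norm_sq, h, psi_eq]
  have h1 : (A * (S.R k + Matrix.diagonal (errorVar S k)) * Aᴴ * S.R i).trace
      = (A * S.R k * Aᴴ * S.R i).trace + ∑ l, errorVar S k l * (Aᴴ * S.R i * Aᴴᴴ) l l := by
    have h0 : (A * Matrix.diagonal (errorVar S k) * Aᴴ * S.R i).trace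
        = (Matrix.diagonal (errorVar S k) * (Aᴴ * S.R i * A)).trace := by
      rw [Matrix.mul_assoc (A * _), Matrix.mul_assoc A, Matrix.trace_mul_comm A, Matrix.mul_assoc]
    rw [Matrix.mul_add, Matrix.add_mul, Matrix.add_mul, Matrix.trace_add,
      Matrix.conjTranspose_conjTranspose, h0]
    congr 1
    simp only [Matrix.trace, Matrix.diag_apply, Matrix.diagonal_mul]
  rw [h1, Finset.mul_sum, add_assoc, add_assoc, add_assoc,
    add_left_comm (∑ l, errorVar S k l * (Aᴴ * S.R i * Aᴴᴴ) l l), ← Finset.sum_add_distrib]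
  congr 2
  refine Finset.sum_congr rfl fun l _ => ?_
  simp only [errorVar, mul_add, Finset.sum_add_distrib, mul_ite, mul_zero, Finset.sum_ite_eq',
    Finset.mem_univ, if_true]
  have h2 : ∑ j, (S.q j : ℂ) * (S.R j l l * (Aᴴ * S.R i * Aᴴᴴ) l l)
      = (∑ j, (S.q j : ℂ) * S.R j l l) * (Aᴴ * S.R i * Aᴴᴴ) l l := by
    rw [Finset.sum_mul]
    exact Finset.sum_congr rfl fun j _ => by ring
  rw [h2]
  ring

theorem SignalMoments.integral_normSq_linearCombiner (hS : SignalMoments mH mN mE mD S X P)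
    (hτp : 0 < τp) (hq : ∀ i, 0 ≤ S.q i) (hφ : S.OrthogonalPilots) (k : Fin K) (hqk : 0 < S.q k)
    (A : Matrix (Fin M) (Fin M) ℂ) (m : Fin M) :
    ∫ ω, (A *ᵥ observation S X P k ω) m * star ((A *ᵥ observation S X P k ω) m) ∂P
      = (A * Psi S k * Aᴴ) m m := by
  have t := hS.tame_observation hτp hq hφ k hqk
  simp only [mulVec_mul_star_eq_sum]
  rw [Tame.integral_sum_sum fun a b => ((t a).mul (t b).conj).const_mul _]
  simp only [integral_const_mul, mul_mul_conjTranspose_apply,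
    ← hS.corr_observation hτp hq hφ k hqk]
  rfl

/-- Correlation between the powers of the combiner and of channel `i` at the same antenna, which
governs the distortion after combining. The last sum arises because the pilot distortion at antenna
`l` carries the energy `|[hᵢ]ₗ|²`, which is correlated with `|[hᵢ]ₘ|²`. -/
theorem SignalMoments.integral_normSq_h_mul_normSq_linearCombiner
    (hS : SignalMoments mH mN mE mD S X P) (hR : ∀ i, (S.R i).PosSemidef)
    (hτp : 0 < τp) (hq : ∀ i, 0 ≤ S.q i) (hφ : S.OrthogonalPilots) (k : Fin K) (hqk : 0 < S.q k)
    (A : Matrix (Fin M) (Fin M) ℂ) (i : Fin K) (m : Fin M) :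
    ∫ ω, (X.h i ω m * star (X.h i ω m)) *
        ((A *ᵥ observation S X P k ω) m * star ((A *ᵥ observation S X P k ω) m)) ∂P
      = S.R i m m * (A * Psi S k * Aᴴ) m m
        + (if i = k then (A * S.R k) m m * star ((A * S.R k) m m) else 0)
        + (S.q i : ℂ) / ((τp : ℂ) * S.q k) *
          ∑ l, (S.ε l : ℂ) ^ 2 * ((A m l * star (A m l)) * (S.R i l m * star (S.R i l m))) := by
  have h := hS.integral_affine_obsError_mul_star hτp hq hφ k hqk
    ((hS.tame_h i m).mul (hS.tame_mulVec_h k A m))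
    (fun l => (hS.tame_h i m).mul (tame_const (A m l)))
    ((hS.tame_h i m).mul (hS.tame_mulVec_h k A m))
    (fun l => (hS.tame_h i m).mul (tame_const (A m l)))
  have e0 : ∀ ω, X.h i ω m * (A *ᵥ X.h k ω) m + ∑ l, X.h i ω m * A m l * obsError S X k l ω
      = X.h i ω m * (A *ᵥ observation S X P k ω) m := fun ω => by
    rw [linearCombiner_apply hτp hq hφ k hqk, mul_add, Finset.mul_sum]
    congr 1
    exact Finset.sum_congr rfl fun l _ => by ring
  have e1 : ∀ x y : ℂ, x * y * star (x * y) = (x * star x) * (y * star y) := fun x y => by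
    rw [star_mul']
    ring
  simp only [e0, e1, hS.integral_normSq_h_mul_normSq_mulVec_h hR] at h
  rw [h, psi_eq]
  have h1 : (A * (S.R k + Matrix.diagonal (errorVar S k)) * Aᴴ) m m
      = (A * S.R k * Aᴴ) m m + ∑ l, errorVar S k l * (A m l * star (A m l)) := by
    rw [Matrix.mul_add, Matrix.add_mul, Matrix.add_apply]
    congr 1
    simp only [Matrix.mul_apply, Matrix.conjTranspose_apply, Matrix.diagonal_apply, mul_ite,
      mul_zero, Finset.sum_ite_eq', Finset.mem_univ, if_true]
    exact Finset.sum_congr rfl fun l _ => by ring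
  rw [h1, mul_add, Finset.mul_sum, Finset.mul_sum, add_assoc, add_assoc, add_assoc,
    add_left_comm (∑ l, S.R i m m * (errorVar S k l * (A m l * star (A m l)))),
    ← Finset.sum_add_distrib]
  congr 2
  refine Finset.sum_congr rfl fun l _ => ?_
  have e2 : ∀ ω, (X.h i ω m * star (X.h i ω m)) * (A m l * star (A m l))
      = (A m l * star (A m l)) * (X.h i ω m * star (X.h i ω m)) := fun ω => mul_comm _ _
  have e3 : ∀ j ω, (X.h j ω l * star (X.h j ω l)) *
        ((A m l * star (A m l)) * (X.h i ω m * star (X.h i ω m)))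
      = (A m l * star (A m l)) *
        ((X.h j ω l * star (X.h j ω l)) * (X.h i ω m * star (X.h i ω m))) := fun j ω => by ring
  simp only [e2, e3, integral_const_mul, hS.two_h, hS.four_h]
  simp only [errorVar, mul_add, Finset.sum_add_distrib, mul_ite, mul_zero, Finset.sum_ite_eq',
    Finset.mem_univ, if_true]
  have h2 : ∑ j, (S.q j : ℂ) * (A m l * star (A m l) * (S.R j l l * S.R i m m))
      = (∑ j, (S.q j : ℂ) * S.R j l l) * (A m l * star (A m l) * S.R i m m) := by
    rw [Finset.sum_mul]
    exact Finset.sum_congr rfl fun j _ => by ring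
  rw [h2, (hR i).1.apply]
  ring

end Combiner

section Data

variable {Ω : Type*} {M K τp : ℕ} {mH mN mE mD m₀ : MeasurableSpace Ω} {S : Params M K τp}
  {X : Signals Ω M K τp} {P : Measure Ω}

/-! ### The data sample -/

/-- The combination `∑ᵢ aᵢ sᵢ + ∑ₘ bₘ nₘ + ∑ₘ dₘ rₘ` of the inputs of the data sample, with random
coefficients. -/
noncomputable def dataMix (X : Signals Ω M K τp) (a : Fin K → Ω → ℂ) (b d : Fin M → Ω → ℂ)
    (ω : Ω) : ℂ :=
  ∑ i, a i ω * X.s i ω + (∑ m, b m ω * X.n ω m + ∑ m, d m ω * X.r ω m)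

lemma dataMix_eq_affine (a : Fin K → Ω → ℂ) (b d : Fin M → Ω → ℂ) (ω : Ω) :
    dataMix X a b d ω = 0 + ∑ x : Fin K ⊕ (Fin M ⊕ Fin M),
      (Sum.elim a (Sum.elim b d) x ω) * (Sum.elim (fun i ω => X.s i ω)
        (Sum.elim (fun a ω => X.n ω a) fun a ω => X.r ω a) x ω) := by
  simp [dataMix, Fintype.sum_sum_type]

variable {a a' : Fin K → Ω → ℂ} {b b' d d' : Fin M → Ω → ℂ}

lemma tame_sumElim {ι κ : Type*} {m : MeasurableSpace Ω} {f : ι → Ω → ℂ} {g : κ → Ω → ℂ}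
    (hf : ∀ i, Tame m P (f i)) (hg : ∀ j, Tame m P (g j)) (x : ι ⊕ κ) :
    Tame m P (Sum.elim f g x) := by
  rcases x with i | j
  exacts [hf i, hg j]

lemma SignalMoments.integral_normSq_dataInput (hS : SignalMoments mH mN mE mD S X P)
    (hp : ∀ i, 0 ≤ S.p i) (i : Fin K) : ∫ ω, ‖dataInput S X i ω‖ ^ 2 ∂P = S.p i := by
  have h := hS.white_data.cov (Sum.inl i) (Sum.inl i)
  simp only [Sum.elim_inl, if_true, ← integral_norm_sq] at h
  have h' : ∫ ω, ‖X.s i ω‖ ^ 2 ∂P = 1 := by exact_mod_cast h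
  simp only [dataInput, norm_mul, mul_pow, integral_const_mul, h', Complex.norm_real,
    Real.norm_eq_abs, sq_abs, Real.sq_sqrt (hp i), mul_one]

lemma SignalMoments.dataDistortion_apply (hS : SignalMoments mH mN mE mD S X P)
    (hp : ∀ i, 0 ≤ S.p i) (ω : Ω) (m : Fin M) :
    dataDistortion S X P ω m =
      (S.ε m : ℂ) * (Real.sqrt (antennaEnergy X S.p m ω) : ℂ) * X.r ω m := by
  have hE : receivedEnergy P X.h (dataInput S X) ω m = antennaEnergy X S.p m ω := by
    simp only [receivedEnergy, antennaEnergy, hS.integral_normSq_dataInput hp]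
  simp [dataDistortion, distortion, realDiag, Matrix.diagonal_mul_diagonal, Matrix.mulVec_diagonal,
    hE]

/-- The coefficient of `[r]ₘ` in the combined distortion. -/
noncomputable def distortionCoeff (S : Params M K τp) (X : Signals Ω M K τp) (v : Ω → Fin M → ℂ)
    (m : Fin M) (ω : Ω) : ℂ :=
  star (v ω m) * ((S.ε m : ℂ) * (Real.sqrt (antennaEnergy X S.p m ω) : ℂ))

variable {v : Ω → Fin M → ℂ}

lemma distortionCoeff_mul_star (hp : ∀ i, 0 ≤ S.p i) (m : Fin M) (ω : Ω) :
    distortionCoeff S X v m ω * star (distortionCoeff S X v m ω) =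
      (S.ε m : ℂ) ^ 2 * ∑ i, (S.p i : ℂ) *
        ((X.h i ω m * star (X.h i ω m)) * (v ω m * star (v ω m))) := by
  have h1 : (Real.sqrt (antennaEnergy X S.p m ω) : ℂ) * (Real.sqrt (antennaEnergy X S.p m ω) : ℂ)
      = ∑ i, (S.p i : ℂ) * (X.h i ω m * star (X.h i ω m)) := by
    rw [← Complex.ofReal_mul, Real.mul_self_sqrt (antennaEnergy_nonneg hp m ω),
      ofReal_antennaEnergy]
  have h2 : star (distortionCoeff S X v m ω) =
      v ω m * ((S.ε m : ℂ) * (Real.sqrt (antennaEnergy X S.p m ω) : ℂ)) := by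
    simp [distortionCoeff]
  rw [h2, distortionCoeff]
  calc _ = (S.ε m : ℂ) ^ 2 * ((Real.sqrt (antennaEnergy X S.p m ω) : ℂ) *
        (Real.sqrt (antennaEnergy X S.p m ω) : ℂ) * (v ω m * star (v ω m))) := by ring
    _ = _ := by
      rw [h1, Finset.sum_mul]
      congr 1
      exact Finset.sum_congr rfl fun j _ => by ring

lemma combine_n (v : Ω → Fin M → ℂ) :
    combine v X.n = dataMix X (fun _ _ => 0) (fun m ω => star (v ω m)) (fun _ _ => 0) := by
  ext ω
  simp [combine, dataMix, dotProduct]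

lemma SignalMoments.combine_dataDistortion (hS : SignalMoments mH mN mE mD S X P)
    (hp : ∀ i, 0 ≤ S.p i) (v : Ω → Fin M → ℂ) :
    combine v (dataDistortion S X P) =
      dataMix X (fun _ _ => 0) (fun _ _ => 0) (distortionCoeff S X v) := by
  ext ω
  simp [combine, dataMix, dotProduct, hS.dataDistortion_apply hp, distortionCoeff, mul_assoc]

lemma SignalMoments.combine_dataReceived (hS : SignalMoments mH mN mE mD S X P)
    (hp : ∀ i, 0 ≤ S.p i) (v : Ω → Fin M → ℂ) :
    combine v (dataReceived S X P) =
      dataMix X (fun i ω => (Real.sqrt (S.p i) : ℂ) * combine v (X.h i) ω)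
        (fun m ω => star (v ω m)) (distortionCoeff S X v) := by
  ext ω
  have h1 : combine v (dataReceived S X P) ω = star (v ω) ⬝ᵥ (∑ i, dataInput S X i ω • X.h i ω)
      + combine v X.n ω + combine v (dataDistortion S X P) ω := by
    simp only [combine, dataReceived, received, dotProduct_add, dataDistortion]
  rw [h1, combine_n, hS.combine_dataDistortion hp, dotProduct_sum]
  simp only [dotProduct_smul, smul_eq_mul, dataMix, zero_mul, Finset.sum_const_zero, zero_add,
    add_zero, ← add_assoc, dataInput]
  congr 2
  exact Finset.sum_congr rfl fun i _ => by rw [combine]; ring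

variable [IsProbabilityMeasure P]

lemma SignalMoments.tame_dataMix (hS : SignalMoments mH mN mE mD S X P)
    (ha : ∀ i, Tame (mH ⊔ (mN ⊔ mE)) P (a i)) (hb : ∀ i, Tame (mH ⊔ (mN ⊔ mE)) P (b i))
    (hd : ∀ i, Tame (mH ⊔ (mN ⊔ mE)) P (d i)) :
    Tame (mH ⊔ (mN ⊔ mE) ⊔ mD) P (dataMix X a b d) := by
  have h := hS.white_data.tame_affine (m' := mH ⊔ (mN ⊔ mE) ⊔ mD) le_sup_left le_sup_right
    (tame_const 0) (tame_sumElim ha (tame_sumElim hb hd))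
  simp only [← dataMix_eq_affine] at h
  exact h

lemma SignalMoments.integral_dataMix (hS : SignalMoments mH mN mE mD S X P)
    (ha : ∀ i, Tame (mH ⊔ (mN ⊔ mE)) P (a i)) (hb : ∀ i, Tame (mH ⊔ (mN ⊔ mE)) P (b i))
    (hd : ∀ i, Tame (mH ⊔ (mN ⊔ mE)) P (d i)) : ∫ ω, dataMix X a b d ω ∂P = 0 := by
  have h := hS.white_data.integral_affine hS.indep_data (tame_const 0)
    (tame_sumElim ha (tame_sumElim hb hd))
  simp only [← dataMix_eq_affine, integral_zero] at h
  exact h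

/-- Given everything that precedes the data sample, its inputs are white, so only products of matching
coefficients contribute. -/
theorem SignalMoments.integral_dataMix_mul_star (hS : SignalMoments mH mN mE mD S X P)
    (ha : ∀ i, Tame (mH ⊔ (mN ⊔ mE)) P (a i)) (hb : ∀ i, Tame (mH ⊔ (mN ⊔ mE)) P (b i))
    (hd : ∀ i, Tame (mH ⊔ (mN ⊔ mE)) P (d i)) (ha' : ∀ i, Tame (mH ⊔ (mN ⊔ mE)) P (a' i))
    (hb' : ∀ i, Tame (mH ⊔ (mN ⊔ mE)) P (b' i)) (hd' : ∀ i, Tame (mH ⊔ (mN ⊔ mE)) P (d' i)) :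
    ∫ ω, dataMix X a b d ω * star (dataMix X a' b' d' ω) ∂P
      = ∑ i, ∫ ω, a i ω * star (a' i ω) ∂P
        + ((S.σ : ℂ) ^ 2 * ∑ m, ∫ ω, b m ω * star (b' m ω) ∂P
        + ∑ m, ∫ ω, d m ω * star (d' m ω) ∂P) := by
  have h := hS.white_data.integral_mul_star hS.indep_data (tame_const 0)
    (tame_sumElim ha (tame_sumElim hb hd)) (tame_const 0)
    (tame_sumElim ha' (tame_sumElim hb' hd'))
  simp only [← dataMix_eq_affine] at h
  rw [h]
  simp [Fintype.sum_sum_type, Finset.mul_sum]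

lemma SignalMoments.tame_distortionCoeff (hS : SignalMoments mH mN mE mD S X P)
    (hv : ∀ m, Tame (mH ⊔ (mN ⊔ mE)) P (fun ω => v ω m)) (m : Fin M) :
    Tame (mH ⊔ (mN ⊔ mE)) P (distortionCoeff S X v m) :=
  (hv m).conj.mul (((hS.tame_antennaEnergy S.p m).sqrt.const_mul _).mono le_sup_left)

lemma SignalMoments.tame_combine_h (hS : SignalMoments mH mN mE mD S X P)
    (hv : ∀ m, Tame (mH ⊔ (mN ⊔ mE)) P (fun ω => v ω m)) (i : Fin K) :
    Tame (mH ⊔ (mN ⊔ mE)) P (combine v (X.h i)) :=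
  Tame.sum (s := Finset.univ) (f := fun m ω => star (v ω m) * X.h i ω m) fun m =>
    (hv m).conj.mul ((hS.tame_h i m).mono le_sup_left)

theorem SignalMoments.integral_normSq_combine_n (hS : SignalMoments mH mN mE mD S X P)
    (hv : ∀ m, Tame (mH ⊔ (mN ⊔ mE)) P (fun ω => v ω m)) :
    ((∫ ω, ‖combine v X.n ω‖ ^ 2 ∂P : ℝ) : ℂ) =
      (S.σ : ℂ) ^ 2 * ∑ m, ∫ ω, v ω m * star (v ω m) ∂P := by
  rw [integral_norm_sq, combine_n, hS.integral_dataMix_mul_star (fun _ => tame_const 0)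
    (fun m => (hv m).conj) (fun _ => tame_const 0) (fun _ => tame_const 0)
    (fun m => (hv m).conj) (fun _ => tame_const 0)]
  simp [mul_comm]

theorem SignalMoments.integral_normSq_combine_dataDistortion
    (hS : SignalMoments mH mN mE mD S X P) (hp : ∀ i, 0 ≤ S.p i)
    (hv : ∀ m, Tame (mH ⊔ (mN ⊔ mE)) P (fun ω => v ω m)) :
    ((∫ ω, ‖combine v (dataDistortion S X P) ω‖ ^ 2 ∂P : ℝ) : ℂ) =
      ∑ m, ∫ ω, distortionCoeff S X v m ω * star (distortionCoeff S X v m ω) ∂P := by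
  rw [integral_norm_sq, hS.combine_dataDistortion hp, hS.integral_dataMix_mul_star
    (fun _ => tame_const 0) (fun _ => tame_const 0) (hS.tame_distortionCoeff hv)
    (fun _ => tame_const 0) (fun _ => tame_const 0) (hS.tame_distortionCoeff hv)]
  simp only [zero_mul, integral_zero, Finset.sum_const_zero, mul_zero, zero_add]

theorem SignalMoments.integral_normSq_distortionCoeff
    (hS : SignalMoments mH mN mE mD S X P) (hp : ∀ i, 0 ≤ S.p i)
    (hv : ∀ m, Tame (mH ⊔ (mN ⊔ mE)) P (fun ω => v ω m)) (m : Fin M) :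
    ∫ ω, distortionCoeff S X v m ω * star (distortionCoeff S X v m ω) ∂P =
      (S.ε m : ℂ) ^ 2 * ∑ i, (S.p i : ℂ) *
        ∫ ω, (X.h i ω m * star (X.h i ω m)) * (v ω m * star (v ω m)) ∂P := by
  simp only [distortionCoeff_mul_star hp, integral_const_mul]
  rw [Tame.integral_sum (m := mH ⊔ (mN ⊔ mE)) fun i => (((((hS.tame_h i m).mul
    (hS.tame_h i m).conj).mono le_sup_left).mul ((hv m).mul (hv m).conj)).const_mul _)]
  simp only [integral_const_mul]

lemma Tame.integral_sub_mean {m : MeasurableSpace Ω} {Y : Ω → ℂ} (hY : Tame m P Y) :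
    ∫ ω, (Y ω - ∫ ω', Y ω' ∂P) * star (Y ω - ∫ ω', Y ω' ∂P) ∂P
      = ∫ ω, Y ω * star (Y ω) ∂P - (∫ ω, Y ω ∂P) * star (∫ ω, Y ω ∂P) := by
  set c := ∫ ω, Y ω ∂P with hc
  have e : ∀ ω, (Y ω - c) * star (Y ω - c) =
      Y ω * star (Y ω) - (star c * Y ω + c * star (Y ω)) + c * star c := fun ω => by
    rw [star_sub]
    ring
  simp only [e]
  have t1 := hY.mul hY.conj
  have t2 := (hY.const_mul (star c)).add (hY.conj.const_mul c)
  rw [integral_add (t1.sub t2).integrable (tame_const (m := m) _).integrable,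
    integral_sub t1.integrable t2.integrable,
    integral_add (hY.const_mul (star c)).integrable (hY.conj.const_mul c).integrable,
    integral_const_mul, integral_const_mul, integral_star, ← hc]
  simp
  ring

/-- The correlation between the combined signal and the symbol of user `k`. -/
theorem SignalMoments.integral_combine_dataReceived_mul_star (hS : SignalMoments mH mN mE mD S X P)
    (hp : ∀ i, 0 ≤ S.p i) (hv : ∀ m, Tame (mH ⊔ (mN ⊔ mE)) P (fun ω => v ω m)) (k : Fin K) :
    ∫ ω, combine v (dataReceived S X P) ω * star (X.s k ω) ∂P =
      (Real.sqrt (S.p k) : ℂ) * ∫ ω, combine v (X.h k) ω ∂P := by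
  have hs : X.s k =
      dataMix X (fun i _ => if i = k then 1 else 0) (fun _ _ => 0) (fun _ _ => 0) := by
    ext ω
    simp [dataMix]
  have ts : ∀ i, Tame (mH ⊔ (mN ⊔ mE)) P (fun ω => (Real.sqrt (S.p i) : ℂ) * combine v (X.h i) ω) :=
    fun i => (hS.tame_combine_h hv i).const_mul _
  have h := hS.integral_dataMix_mul_star ts (fun m => (hv m).conj) (hS.tame_distortionCoeff hv)
    (a' := fun i _ => if i = k then 1 else 0) (fun _ => tame_const _)
    (b' := fun _ _ => 0) (fun _ => tame_const 0) (d' := fun _ _ => 0) (fun _ => tame_const 0)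
  rw [← hS.combine_dataReceived hp, ← hs] at h
  rw [h, Finset.sum_eq_single k (fun i _ hi => by simp [hi]) (by simp)]
  simp [integral_const_mul]

/-- The effective SINR is the ratio of moments of the combining vector: the interference terms are
uncorrelated, and each inner product `vᴴ hᵢ` multiplies an independent unit-power symbol. -/
theorem SignalMoments.effectiveSINR_eq_momentSINR (hS : SignalMoments mH mN mE mD S X P)
    (hp : ∀ i, 0 ≤ S.p i) (hv : ∀ m, Tame (mH ⊔ (mN ⊔ mE)) P (fun ω => v ω m)) (k : Fin K) :
    effectiveSINR P (combine v (dataReceived S X P)) (X.s k) = momentSINR S X P v k := by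
  have hsp : ∀ i, (Real.sqrt (S.p i) : ℂ) * (Real.sqrt (S.p i) : ℂ) = S.p i := fun i => by
    rw [← Complex.ofReal_mul, Real.mul_self_sqrt (hp i)]
  set c := ∫ ω, combine v (X.h k) ω ∂P with hc
  -- the coefficients of the symbols once the part of the signal correlated with `sₖ` is removed
  set a : Fin K → Ω → ℂ := fun i ω => (Real.sqrt (S.p i) : ℂ) *
    (combine v (X.h i) ω - if i = k then c else 0) with ha_def
  have ha : ∀ i, Tame (mH ⊔ (mN ⊔ mE)) P (a i) := fun i =>
    ((hS.tame_combine_h hv i).sub (tame_const _)).const_mul _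
  have hdiff : (fun ω => combine v (dataReceived S X P) ω -
      (∫ ω', combine v (dataReceived S X P) ω' * star (X.s k ω') ∂P) * X.s k ω) =
      dataMix X a (fun m ω => star (v ω m)) (distortionCoeff S X v) := by
    ext ω
    rw [hS.integral_combine_dataReceived_mul_star hp hv, ← hc, hS.combine_dataReceived hp]
    have : ∑ i, a i ω * X.s i ω = ∑ i, (Real.sqrt (S.p i) : ℂ) * combine v (X.h i) ω * X.s i ω
        - (Real.sqrt (S.p k) : ℂ) * c * X.s k ω := by
      have h1 : ∑ i, (if i = k then (Real.sqrt (S.p k) : ℂ) * c * X.s k ω else 0)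
          = (Real.sqrt (S.p k) : ℂ) * c * X.s k ω := by simp
      rw [← h1, ← Finset.sum_sub_distrib]
      refine Finset.sum_congr rfl fun i _ => ?_
      by_cases hi : i = k
      · subst hi
        simp only [ha_def, if_true]
        ring
      · simp [ha_def, hi]
    simp only [dataMix, this]
    ring
  have hvar : ((complexVar P fun ω => combine v (dataReceived S X P) ω -
      (∫ ω', combine v (dataReceived S X P) ω' * star (X.s k ω') ∂P) * X.s k ω : ℝ) : ℂ)
      = (((∑ i, (∫ ω, ‖combine v (X.h i) ω‖ ^ 2 ∂P) * S.p i) - ‖c‖ ^ 2 * S.p k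
        + (∫ ω, ‖combine v X.n ω‖ ^ 2 ∂P)
        + ∫ ω, ‖combine v (dataDistortion S X P) ω‖ ^ 2 ∂P : ℝ) : ℂ) := by
    rw [hdiff, complexVar]
    simp only [hS.integral_dataMix ha (fun m => (hv m).conj) (hS.tame_distortionCoeff hv), sub_zero]
    rw [integral_norm_sq, hS.integral_dataMix_mul_star ha (fun m => (hv m).conj)
      (hS.tame_distortionCoeff hv) ha (fun m => (hv m).conj) (hS.tame_distortionCoeff hv)]
    have hn := hS.integral_normSq_combine_n hv
    have hd := hS.integral_normSq_combine_dataDistortion hp hv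
    have hs : ∑ i, ∫ ω, a i ω * star (a i ω) ∂P =
        ∑ i, ((∫ ω, ‖combine v (X.h i) ω‖ ^ 2 ∂P : ℝ) : ℂ) * S.p i - (‖c‖ ^ 2 : ℝ) * S.p k := by
      have hi : ∀ i, ∫ ω, a i ω * star (a i ω) ∂P =
          ((∫ ω, ‖combine v (X.h i) ω‖ ^ 2 ∂P : ℝ) : ℂ) * S.p i -
            if i = k then ((‖c‖ ^ 2 : ℝ) : ℂ) * S.p k else 0 := fun i => by
        have e : ∀ ω, a i ω * star (a i ω) = (S.p i : ℂ) *
            ((combine v (X.h i) ω - if i = k then c else 0) *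
              star (combine v (X.h i) ω - if i = k then c else 0)) := fun ω => by
          have h1 : star (Real.sqrt (S.p i) : ℂ) = Real.sqrt (S.p i) := by simp
          simp only [ha_def, star_mul', h1, ← hsp i]
          ring
        simp only [e, integral_const_mul]
        by_cases hik : i = k
        · subst hik
          have hcc : ((‖c‖ ^ 2 : ℝ) : ℂ) = c * star c := by
            simp [Complex.mul_conj, Complex.normSq_eq_norm_sq]
          simp only [if_true]
          rw [hc, (hS.tame_combine_h hv i).integral_sub_mean, ← hc, ← integral_norm_sq, hcc]
          ring
        · simp only [hik, if_false, sub_zero, ← integral_norm_sq]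
          ring
      simp only [hi, Finset.sum_sub_distrib, Finset.sum_ite_eq', Finset.mem_univ, if_true]
    rw [hs, ← hd]
    have e : ∀ m ω, star (v ω m) * star (star (v ω m)) = v ω m * star (v ω m) := fun m ω => by
      rw [star_star, mul_comm]
    simp only [e]
    rw [← hn]
    push_cast
    ring
  rw [effectiveSINR, momentSINR]
  congr 1
  · rw [hS.integral_combine_dataReceived_mul_star hp hv, ← hc, norm_mul, mul_pow, Complex.norm_real,
      Real.norm_eq_abs, sq_abs, Real.sq_sqrt (hp k), mul_comm]
  · exact Complex.ofReal_injective hvar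

end Data

/-! ### The closed form -/

section ClosedFormEval

variable {M K τp : ℕ} {S : Params M K τp}

lemma trace_realDiag_sq_mul (ε : Fin M → ℝ) (Y : Matrix (Fin M) (Fin M) ℂ) :
    (realDiag ε ^ 2 * Y).trace = ∑ m, (ε m : ℂ) ^ 2 * Y m m := by
  simp [realDiag, Matrix.trace, Matrix.diagonal_pow, Matrix.diagonal_mul]

lemma absSq_apply (Y : Matrix (Fin M) (Fin M) ℂ) (a b : Fin M) :
    absSq Y a b = Y a b * star (Y a b) := by
  simp [absSq, Complex.mul_conj, Complex.normSq_eq_norm_sq]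

lemma diagPart_apply_self (Y : Matrix (Fin M) (Fin M) ℂ) (a : Fin M) :
    diagPart Y a a = Y a a := by
  simp [diagPart]

lemma trace_distortion_mul_diagPart (ε : Fin M → ℝ) (Y Z : Matrix (Fin M) (Fin M) ℂ) :
    (realDiag ε ^ 2 * diagPart Y * Z).trace = ∑ m, (ε m : ℂ) ^ 2 * (Y m m * Z m m) := by
  rw [Matrix.mul_assoc, trace_realDiag_sq_mul]
  simp [diagPart, Matrix.diagonal_mul]

lemma absSq_mul_realDiag_sq_mul_absSq_apply (ε : Fin M → ℝ) (Y Z : Matrix (Fin M) (Fin M) ℂ)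
    (m : Fin M) : (absSq Y * realDiag ε ^ 2 * absSq Z) m m =
      ∑ l, (ε l : ℂ) ^ 2 * ((Y m l * star (Y m l)) * (Z l m * star (Z l m))) := by
  rw [Matrix.mul_apply]
  simp only [realDiag, Matrix.diagonal_pow, Matrix.mul_diagonal, absSq_apply, Pi.pow_apply]
  exact Finset.sum_congr rfl fun l _ => by ring

/-- The covariance matrix `Rₖ Ψₖ⁻¹ Rₖ` of the channel estimate. -/
noncomputable def estimateCov (S : Params M K τp) (k : Fin K) : Matrix (Fin M) (Fin M) ℂ :=
  S.R k * (Psi S k)⁻¹ * S.R k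

/-- The denominator written out in matrix entries. -/
lemma mrDen_eq (k : Fin K) :
    mrDen S k = (S.p k : ℂ) * ∑ m, (S.ε m : ℂ) ^ 2 *
        (estimateCov S k m m * star (estimateCov S k m m))
      + ∑ i, ((S.p i : ℂ) * S.q i / ((τp : ℂ) * S.q k)) *
        (∑ m, (S.ε m : ℂ) ^ 2 *
            ((S.R i * estimator S k) m m * star ((S.R i * estimator S k) m m))
          + ∑ m, (S.ε m : ℂ) ^ 2 * ∑ l, (S.ε l : ℂ) ^ 2 *
            ((estimator S k m l * star (estimator S k m l)) * (S.R i l m * star (S.R i l m))))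
      + (∑ i, (S.p i : ℂ) * (S.R i * estimateCov S k).trace
        + (S.σ : ℂ) ^ 2 * (estimateCov S k).trace
        + ∑ i, (S.p i : ℂ) * ∑ m, (S.ε m : ℂ) ^ 2 * (S.R i m m * estimateCov S k m m)) := by
  simp only [mrDen, Matrix.trace_add, trace_realDiag_sq_mul, absSq_apply, diagPart_apply_self,
    absSq_mul_realDiag_sq_mul_absSq_apply, Matrix.add_mul, Finset.sum_mul, Matrix.trace_sum,
    Matrix.smul_mul, Matrix.trace_smul, smul_eq_mul, Matrix.one_mul,
    trace_distortion_mul_diagPart, estimateCov, Matrix.mul_assoc (S.R _) (S.R k) (Psi S k)⁻¹,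
    estimator]

lemma trace_mul_nonneg_of_posSemidef {A B : Matrix (Fin M) (Fin M) ℂ} (hA : A.PosSemidef)
    (hB : B.PosSemidef) : 0 ≤ (A * B).trace := by
  obtain ⟨C, rfl⟩ := CStarAlgebra.nonneg_iff_eq_star_mul_self.1 (Matrix.nonneg_iff_posSemidef.2 hA)
  rw [Matrix.mul_assoc, Matrix.trace_mul_comm]
  exact (hB.mul_mul_conjTranspose_same C).trace_nonneg

variable {k : Fin K}

lemma posSemidef_estimateCov (hR : ∀ i, (S.R i).PosSemidef) (hΨ : (Psi S k).PosDef) :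
    (estimateCov S k).PosSemidef := by
  have := hΨ.inv.posSemidef.mul_mul_conjTranspose_same (S.R k)
  rwa [(hR k).1.eq] at this

/-- The estimate of a nonzero channel has positive power, because `Ψₖ⁻¹` is positive definite. -/
lemma trace_estimateCov_pos (hR : ∀ i, (S.R i).PosSemidef) (hΨ : (Psi S k).PosDef)
    (h0 : S.R k ≠ 0) : 0 < (estimateCov S k).trace := by
  have hT := posSemidef_estimateCov hR hΨ
  refine lt_of_le_of_ne hT.trace_nonneg fun h => h0 ?_
  have hz : estimateCov S k = 0 := hT.trace_eq_zero_iff.1 h.symm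
  ext a b
  by_contra hab
  have hx : S.R k *ᵥ Pi.single b 1 ≠ 0 := fun hx => hab <| by
    simpa using congrFun hx a
  have hpos := hΨ.inv.dotProduct_mulVec_pos hx
  have e : star (S.R k *ᵥ Pi.single b 1) ⬝ᵥ (Psi S k)⁻¹ *ᵥ (S.R k *ᵥ Pi.single b 1)
      = star (Pi.single b 1) ⬝ᵥ estimateCov S k *ᵥ Pi.single b 1 := by
    rw [Matrix.star_mulVec, (hR k).1.eq, ← Matrix.dotProduct_mulVec, Matrix.mulVec_mulVec,
      Matrix.mulVec_mulVec, estimateCov, Matrix.mul_assoc]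
  rw [e, hz] at hpos
  simp at hpos

lemma estimator_conjTranspose (hR : ∀ i, (S.R i).PosSemidef) (hΨ : (Psi S k).PosDef) :
    (estimator S k)ᴴ = (Psi S k)⁻¹ * S.R k := by
  rw [estimator, Matrix.conjTranspose_mul, hΨ.inv.1.eq, (hR k).1.eq]

lemma estimator_mul_psi_mul_conjTranspose (hR : ∀ i, (S.R i).PosSemidef) (hΨ : (Psi S k).PosDef) :
    estimator S k * Psi S k * (estimator S k)ᴴ = estimateCov S k := by
  rw [estimator_conjTranspose hR hΨ, estimator, Matrix.mul_assoc (S.R k),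
    Matrix.nonsing_inv_mul _ ((Matrix.isUnit_iff_isUnit_det _).1 hΨ.isUnit), Matrix.mul_one,
    ← Matrix.mul_assoc, estimateCov]

lemma mul_star_self_nonneg (z : ℂ) : 0 ≤ z * star z := by
  simpa [mul_comm] using star_mul_self_nonneg z

lemma ofReal_sq_nonneg (x : ℝ) : (0 : ℂ) ≤ (x : ℂ) ^ 2 := by
  rw [← Complex.ofReal_pow]
  exact Complex.zero_le_real.2 (sq_nonneg x)

/-- Every term of the denominator is nonnegative, and the thermal noise term is positive. -/
theorem mrDen_pos (hR : ∀ i, (S.R i).PosSemidef) (hΨ : (Psi S k).PosDef) (hσ : 0 < S.σ)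
    (hp : ∀ i, 0 ≤ S.p i) (hq : ∀ i, 0 ≤ S.q i) (h0 : S.R k ≠ 0) : 0 < mrDen S k := by
  have hT := posSemidef_estimateCov hR hΨ
  have hp' : ∀ i, (0 : ℂ) ≤ S.p i := fun i => Complex.zero_le_real.2 (hp i)
  have hσ' : (0 : ℂ) < (S.σ : ℂ) ^ 2 := by
    rw [← Complex.ofReal_pow]
    exact Complex.zero_lt_real.2 (by positivity)
  have hc : ∀ i, (0 : ℂ) ≤ (S.p i : ℂ) * S.q i / ((τp : ℂ) * S.q k) := fun i => by
    rw [show (S.p i : ℂ) * S.q i / ((τp : ℂ) * S.q k)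
      = ((S.p i * S.q i / (τp * S.q k) : ℝ) : ℂ) by push_cast; rfl]
    have h1 := hp i
    have h2 := hq i
    have h3 := hq k
    exact Complex.zero_le_real.2 (by positivity)
  rw [mrDen_eq]
  refine add_pos_of_nonneg_of_pos (add_nonneg (mul_nonneg (hp' k) (Finset.sum_nonneg fun m _ =>
    mul_nonneg (ofReal_sq_nonneg _) (mul_star_self_nonneg _))) (Finset.sum_nonneg fun i _ =>
    mul_nonneg (hc i) (add_nonneg (Finset.sum_nonneg fun m _ =>
      mul_nonneg (ofReal_sq_nonneg _) (mul_star_self_nonneg _)) (Finset.sum_nonneg fun m _ =>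
      mul_nonneg (ofReal_sq_nonneg _) (Finset.sum_nonneg fun l _ =>
        mul_nonneg (ofReal_sq_nonneg _) (mul_nonneg (mul_star_self_nonneg _)
          (mul_star_self_nonneg _))))))) ?_
  refine add_pos_of_pos_of_nonneg (add_pos_of_nonneg_of_pos (Finset.sum_nonneg fun i _ =>
    mul_nonneg (hp' i) (trace_mul_nonneg_of_posSemidef (hR i) hT))
    (mul_pos hσ' (trace_estimateCov_pos hR hΨ h0))) (Finset.sum_nonneg fun i _ =>
    mul_nonneg (hp' i) (Finset.sum_nonneg fun m _ => mul_nonneg (ofReal_sq_nonneg _)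
      (mul_nonneg (hR i).diag_nonneg hT.diag_nonneg)))

end ClosedFormEval

section MomentClosedForm

variable {Ω : Type*} {M K τp : ℕ} {mH mN mE mD m₀ : MeasurableSpace Ω} {S : Params M K τp}
  {X : Signals Ω M K τp} {P : Measure Ω} [IsProbabilityMeasure P]

/-- The moment form of the SINR in closed form. In the denominator, the coherent gain of user `k`
cancels against `|E vᴴ hₖ|² pₖ`. -/
theorem SignalMoments.momentSINR_eq (hS : SignalMoments mH mN mE mD S X P) (hτp : 0 < τp)
    (hR : ∀ i, (S.R i).PosSemidef) (hσ : 0 < S.σ) (hp : ∀ i, 0 ≤ S.p i) (hq : ∀ i, 0 ≤ S.q i)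
    (hφ : S.OrthogonalPilots) (k : Fin K) (hqk : 0 < S.q k) :
    ((momentSINR S X P (mrCombiner S X P k) k : ℝ) : ℂ) = mrNum S k / mrDen S k := by
  have hΨ := posDef_psi hτp hR hσ hq k hqk
  have hT := posSemidef_estimateCov hR hΨ
  have hv := hS.tame_linearCombiner hτp hq hφ k hqk (estimator S k)
  have hAR : estimator S k * S.R k = estimateCov S k := rfl
  have htr : star (estimateCov S k).trace = (estimateCov S k).trace := by
    rw [← Matrix.trace_conjTranspose, hT.1.eq]
  have hmean := hS.integral_combine_h hτp hq hφ k hqk (estimator S k)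
  rw [hAR, htr] at hmean
  rw [hS.mrCombiner_eq hτp hq hφ k hqk, momentSINR, hmean, Complex.ofReal_div]
  have hnorm : ((‖(estimateCov S k).trace‖ ^ 2 : ℝ) : ℂ) = (estimateCov S k).trace ^ 2 := by
    rw [← Complex.normSq_eq_norm_sq, ← Complex.mul_conj, ← Complex.star_def, htr, sq]
  have hnoise : ((∫ ω, ‖combine (fun ω => estimator S k *ᵥ observation S X P k ω) X.n ω‖ ^ 2 ∂P : ℝ)
      : ℂ) = (S.σ : ℂ) ^ 2 * (estimateCov S k).trace := by
    rw [hS.integral_normSq_combine_n hv]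
    simp only [hS.integral_normSq_linearCombiner hτp hq hφ k hqk,
      estimator_mul_psi_mul_conjTranspose hR hΨ]
    rfl
  have hdist : ((∫ ω, ‖combine (fun ω => estimator S k *ᵥ observation S X P k ω)
      (dataDistortion S X P) ω‖ ^ 2 ∂P : ℝ) : ℂ) =
      (S.p k : ℂ) * ∑ m, (S.ε m : ℂ) ^ 2 *
        (estimateCov S k m m * star (estimateCov S k m m))
      + (∑ i, (S.p i : ℂ) * ∑ m, (S.ε m : ℂ) ^ 2 * (S.R i m m * estimateCov S k m m)
      + ∑ i, ((S.p i : ℂ) * S.q i / ((τp : ℂ) * S.q k)) *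
          ∑ m, (S.ε m : ℂ) ^ 2 * ∑ l, (S.ε l : ℂ) ^ 2 *
            ((estimator S k m l * star (estimator S k m l)) * (S.R i l m * star (S.R i l m)))) := by
    rw [hS.integral_normSq_combine_dataDistortion hp hv]
    simp only [hS.integral_normSq_distortionCoeff hp hv,
      hS.integral_normSq_h_mul_normSq_linearCombiner hR hτp hq hφ k hqk,
      estimator_mul_psi_mul_conjTranspose hR hΨ, hAR]
    have e : ∀ m, (S.ε m : ℂ) ^ 2 * ∑ i, (S.p i : ℂ) * (S.R i m m * estimateCov S k m m
          + (if i = k then estimateCov S k m m * star (estimateCov S k m m) else 0)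
          + (S.q i : ℂ) / ((τp : ℂ) * S.q k) * ∑ l, (S.ε l : ℂ) ^ 2 *
            ((estimator S k m l * star (estimator S k m l)) * (S.R i l m * star (S.R i l m))))
        = (S.p k : ℂ) * ((S.ε m : ℂ) ^ 2 * (estimateCov S k m m * star (estimateCov S k m m)))
          + (∑ i, (S.p i : ℂ) * ((S.ε m : ℂ) ^ 2 * (S.R i m m * estimateCov S k m m))
          + ∑ i, ((S.p i : ℂ) * S.q i / ((τp : ℂ) * S.q k)) * ((S.ε m : ℂ) ^ 2 *
            ∑ l, (S.ε l : ℂ) ^ 2 * ((estimator S k m l * star (estimator S k m l)) *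
              (S.R i l m * star (S.R i l m))))) := fun m => by
      have h1 : ∑ i, (if i = k then (S.p k : ℂ) * ((S.ε m : ℂ) ^ 2 *
          (estimateCov S k m m * star (estimateCov S k m m))) else 0) =
          (S.p k : ℂ) * ((S.ε m : ℂ) ^ 2 *
          (estimateCov S k m m * star (estimateCov S k m m))) := by simp
      rw [← h1, Finset.mul_sum, ← Finset.sum_add_distrib, ← Finset.sum_add_distrib]
      refine Finset.sum_congr rfl fun i _ => ?_
      by_cases hik : i = k
      · subst hik
        simp only [if_true]
        ring
      · simp only [hik, if_false]
        ring
    simp only [e, Finset.sum_add_distrib]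
    simp only [Finset.mul_sum]
    congr 1
    congr 1
    · exact Finset.sum_comm
    · exact Finset.sum_comm
  congr 1
  · rw [Complex.ofReal_mul, hnorm, mul_comm]
    rfl
  · have hAstar : ∀ i l, ((estimator S k)ᴴ * S.R i) l l * star (((estimator S k)ᴴ * S.R i) l l)
        = (S.R i * estimator S k) l l * star ((S.R i * estimator S k) l l) := fun i l => by
      have h1 : (estimator S k)ᴴ * S.R i = (S.R i * estimator S k)ᴴ := by
        rw [Matrix.conjTranspose_mul, (hR i).1.eq]
      rw [h1, Matrix.conjTranspose_apply, star_star, mul_comm]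
    have hsig : ((∑ i, (∫ ω, ‖combine (fun ω => estimator S k *ᵥ observation S X P k ω)
        (X.h i) ω‖ ^ 2 ∂P) * S.p i : ℝ) : ℂ) = (S.p k : ℂ) * (estimateCov S k).trace ^ 2
        + (∑ i, (S.p i : ℂ) * (S.R i * estimateCov S k).trace
        + ∑ i, ((S.p i : ℂ) * S.q i / ((τp : ℂ) * S.q k)) * ∑ m, (S.ε m : ℂ) ^ 2 *
            ((S.R i * estimator S k) m m * star ((S.R i * estimator S k) m m))) := by
      have h1 : ∑ i, (if i = k then (S.p k : ℂ) * (estimateCov S k).trace ^ 2 else 0)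
          = (S.p k : ℂ) * (estimateCov S k).trace ^ 2 := by simp
      rw [Complex.ofReal_sum, ← h1, ← Finset.sum_add_distrib, ← Finset.sum_add_distrib]
      refine Finset.sum_congr rfl fun i _ => ?_
      rw [Complex.ofReal_mul, hS.integral_normSq_combine_h hR hτp hq hφ k hqk,
        estimator_mul_psi_mul_conjTranspose hR hΨ, hAR, htr, Matrix.trace_mul_comm]
      simp only [hAstar]
      by_cases hik : i = k
      · subst hik
        simp only [if_true]
        ring
      · simp only [hik, Ne.symm hik, if_false]
        ring
    rw [Complex.ofReal_add, Complex.ofReal_add, Complex.ofReal_sub, hsig, hnoise, hdist,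
      Complex.ofReal_mul, hnorm, mrDen_eq]
    simp only [mul_add, Finset.sum_add_distrib]
    ring

/-- All claims about the SINR hold for any inputs that have the moments and the independence collected
in `SignalMoments`; the exact laws play no further role. -/
theorem SignalMoments.closedForm (hS : SignalMoments mH mN mE mD S X P) (hτp : 0 < τp)
    (hR : ∀ i, (S.R i).PosSemidef) (hσ : 0 < S.σ) (hp : ∀ i, 0 ≤ S.p i) (hq : ∀ i, 0 ≤ S.q i)
    (hφ : S.OrthogonalPilots) (k : Fin K) (hqk : 0 < S.q k) :
    ((∀ m, MemLp (fun ω => X.h k ω m) 2 P) ∧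
      (∀ m, MemLp (fun ω => observation S X P k ω m) 2 P) ∧
      (∀ i, MemLp (combine (mrCombiner S X P k) (X.h i)) 2 P) ∧
      MemLp (combine (mrCombiner S X P k) X.n) 2 P ∧
      MemLp (combine (mrCombiner S X P k) (dataDistortion S X P)) 2 P ∧
      MemLp (combine (mrCombiner S X P k) (dataReceived S X P)) 2 P ∧
      MemLp (X.s k) 2 P) ∧
    IsUnit (corr P (observation S X P k) (observation S X P k)).det ∧
    IsUnit (Psi S k).det ∧
    (S.R k ≠ 0 → 0 < mrDen S k) ∧
    ((effectiveSINR P (combine (mrCombiner S X P k) (dataReceived S X P)) (X.s k) : ℝ) : ℂ)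
      = mrNum S k / mrDen S k ∧
    ((momentSINR S X P (mrCombiner S X P k) k : ℝ) : ℂ) = mrNum S k / mrDen S k := by
  have hΨ := posDef_psi hτp hR hσ hq k hqk
  have hdet : IsUnit (Psi S k).det := (Matrix.isUnit_iff_isUnit_det _).1 hΨ.isUnit
  have hv : ∀ m, Tame (mH ⊔ (mN ⊔ mE)) P (fun ω => mrCombiner S X P k ω m) := by
    rw [hS.mrCombiner_eq hτp hq hφ k hqk]
    exact hS.tame_linearCombiner hτp hq hφ k hqk (estimator S k)
  have h0 : ∀ {ι : Type} (_ : ι), Tame (mH ⊔ (mN ⊔ mE)) P (fun _ => 0) := fun _ => tame_const 0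
  refine ⟨⟨fun m => (hS.tame_h k m).memLp_two,
    fun m => (hS.tame_observation hτp hq hφ k hqk m).memLp_two,
    fun i => (hS.tame_combine_h hv i).memLp_two, ?_, ?_, ?_,
    (hS.white_data.tame (Sum.inl k)).memLp_two⟩, ?_, hdet, mrDen_pos hR hΨ hσ hp hq, ?_,
    hS.momentSINR_eq hτp hR hσ hp hq hφ k hqk⟩
  · rw [combine_n]
    exact (hS.tame_dataMix h0 (fun m => (hv m).conj) h0).memLp_two
  · rw [hS.combine_dataDistortion hp]
    exact (hS.tame_dataMix h0 h0 (hS.tame_distortionCoeff hv)).memLp_two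
  · rw [hS.combine_dataReceived hp]
    exact (hS.tame_dataMix (fun i => (hS.tame_combine_h hv i).const_mul _)
      (fun m => (hv m).conj) (hS.tame_distortionCoeff hv)).memLp_two
  · rwa [hS.corr_observation hτp hq hφ k hqk]
  · rw [hS.effectiveSINR_eq_momentSINR hp hv]
    exact hS.momentSINR_eq hτp hR hσ hp hq hφ k hqk

end MomentClosedForm

end MIMO

theorem corollary1 {Ω : Type*} [MeasurableSpace Ω] (P : Measure Ω) [IsProbabilityMeasure P]
    {M K τp : ℕ} (hτp : 0 < τp) (S : Params M K τp) (X : Signals Ω M K τp)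
    (hR : ∀ i, (S.R i).PosSemidef) (hσ : 0 < S.σ) (hp : ∀ i, 0 ≤ S.p i) (hq : ∀ i, 0 ≤ S.q i)
    (hφ : S.OrthogonalPilots) (hX : X.HasModelLaw S P)
    (k : Fin K) (hqk : 0 < S.q k) :
    -- all moments that enter the estimator and the effective SINR exist
    ((∀ m, MemLp (fun ω => X.h k ω m) 2 P) ∧
      (∀ m, MemLp (fun ω => observation S X P k ω m) 2 P) ∧
      (∀ i, MemLp (combine (mrCombiner S X P k) (X.h i)) 2 P) ∧
      MemLp (combine (mrCombiner S X P k) X.n) 2 P ∧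
      MemLp (combine (mrCombiner S X P k) (dataDistortion S X P)) 2 P ∧
      MemLp (combine (mrCombiner S X P k) (dataReceived S X P)) 2 P ∧
      MemLp (X.s k) 2 P) ∧
    -- the matrices that are inverted are invertible
    IsUnit (corr P (observation S X P k) (observation S X P k)).det ∧
    IsUnit (Psi S k).det ∧
    -- the closed form has a positive denominator, except in the degenerate case of a zero channel
    (S.R k ≠ 0 → 0 < mrDen S k) ∧
    -- the effective SINR equals the closed form
    ((effectiveSINR P (combine (mrCombiner S X P k) (dataReceived S X P)) (X.s k) : ℝ) : ℂ)
      = mrNum S k / mrDen S k ∧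
    ((momentSINR S X P (mrCombiner S X P k) k : ℝ) : ℂ) = mrNum S k / mrDen S k := by
  obtain ⟨mH, mN, mE, mD, hS⟩ := exists_signalMoments hR hX
  exact hS.closedForm hτp hR hσ hp hq hφ k hqk
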